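/- Let $\Omega,\Omega_1\subset\mathbb R^2$ be bounded domains (nonempty, open, connected) with Lipschitz boundary, let $\mathcal S$ be a finite subgroup of $\mathrm{SO}(3)$, let $I_1\colon\overline\Omega\to \mathrm{SO}(3)/\mathcal S$ and $I_2\colon\overline\Omega_1\to \mathrm{SO}(3)/\mathcal S$ be continuous, and let $\alpha,\beta>0$. On the set of left cosets $[R]=R\mathcal S$ consider the distance $$d_{\mathrm{SO}(3)/\mathcal S}([R_1],[R_2])=\min_{S\in\mathcal S}\sqrt2\,\arccos\!\Big(\tfrac12\big(\operatorname{tr}((R_1S)^{\mathrm T}R_2)-1\big)\Big).$$ For $A\in\mathbb R^{2,2}$ with $\det A>0$ let $A=R_AV_A$ be its unique polar decomposition with $R_A\in\mathrm{SO}(2)$ and $V_A$ symmetric positive semidefinite, and put $\mathrm R(A)=\begin{pmatrix}R_A&0\\0&1\end{pmatrix}\in\mathrm{SO}(3)$. Let $f(t)=t^{-1}+t$ for $t>0$ and $f(t)=+\infty$ for $t\le 0$. For $u\in L^1(\Omega,\mathbb R^{2,2})$ let $$\mathrm{TV}(u)=\sup\Big\{\int_\Omega\langle u,\operatorname{div}\psi\rangle\,dx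 \;:\; \psi\in C^1_c(\Omega,\mathbb R^{2\times2\times2}),\ \sup_{x}\|\psi(x)\|_F\le1\Big\},\qquad (\operatorname{div}\psi)_{i,j}=\sum_k\partial_k\psi_{k,i,j},$$ and let $\mathrm{BV}(\Omega,\mathbb R^{2,2})$ be the set of all $u\in L^1(\Omega,\mathbb R^{2,2})$ with $\mathrm{TV}(u)<\infty$. Let $$\mathrm{BV}^2(\Omega,\overline\Omega_1)=\{\varphi\in W^{1,1}(\Omega,\mathbb R^2):\ \varphi(x)\in\overline\Omega_1\text{ for a.e. }x\in\Omega,\ \nabla\varphi\in\mathrm{BV}(\Omega,\mathbb R^{2,2})\},$$ where $\nabla\varphi=(\partial_j\varphi_i)_{i,j}$ is the weak Jacobian matrix, and let $\mathrm{Id}$ denote the $2\times 2$ identity matrix. Then the functional $$\mathcal E(\varphi)=\int_\Omega d_{\mathrm{SO}(3)/\mathcal S}\big(\mathrm R(\nabla\varphi)I_1,\,I_2\circ\varphi\big)\,dx+\alpha\,\mathrm{TV}(\nabla\varphi-\mathrm{Id})+\beta\int_\Omega f(\det\nabla\varphi)\,dx\in[0,+\infty]$$ (where $\mathcal E(\varphi)=+\infty$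 whenever $\det\nabla\varphi\le0$ on a set of positive measure) has a minimizer over $\mathrm{BV}^2(\Omega,\overline\Omega_1)$, with finite energy: there is $\varphi\in\mathrm{BV}^2(\Omega,\overline\Omega_1)$ with $\mathcal E(\varphi)<\infty$ and $\mathcal E(\varphi)\le\mathcal E(\psi)$ for all $\psi\in\mathrm{BV}^2(\Omega,\overline\Omega_1)$. -/

import Mathlib

open MeasureTheory Set
open scoped ENNReal NNReal Topology

noncomputable section

namespace EBSDFlow

/-- The Euclidean plane. -/
abbrev Plane : Type := EuclideanSpace ℝ (Fin 2)

/-- Real `2 × 2` matrices. -/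
abbrev Mat2 : Type := Matrix (Fin 2) (Fin 2) ℝ

/-- The rotation group of the plane. -/
abbrev SO2 : Type := Matrix.specialOrthogonalGroup (Fin 2) ℝ

/-- The rotation group of three-dimensional space. -/
abbrev SO3 : Type := Matrix.specialOrthogonalGroup (Fin 3) ℝ

/-! ### Domains -/

/-- The boundary of `Ω` is Lipschitz: near each boundary point, and after a linear isometry of the
plane, `Ω` is the strict epigraph of a Lipschitz function. -/
def HasLipschitzBoundary (Ω : Set Plane) : Prop :=
  ∀ p ∈ frontier Ω, ∃ r : ℝ, 0 < r ∧ ∃ (T : Plane ≃ₗᵢ[ℝ] Plane) (K : ℝ≥0) (g : ℝ → ℝ),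
    LipschitzWith K g ∧ ∀ x ∈ Metric.ball p r, (x ∈ Ω ↔ g (T x 0) < T x 1)

/-- Bounded domains (nonempty connected open sets) with Lipschitz boundary. -/
structure IsBoundedLipschitzDomain (Ω : Set Plane) : Prop where
  isOpen : IsOpen Ω
  isConnected : IsConnected Ω
  isBounded : Bornology.IsBounded Ω
  lipschitz : HasLipschitzBoundary Ω

/-! ### Weak derivatives and total variation -/

/-- The partial derivative `∂ᵢ η (x)` of a real function on the plane. -/
def pderiv (i : Fin 2) (η : Plane → ℝ) (x : Plane) : ℝ :=
  fderiv ℝ η x (EuclideanSpace.single i 1)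

/-- `G ∈ L¹(Ω, ℝ^{2,2})` is the weak Jacobian matrix of `φ` on `Ω`: `G i j` is the weak partial
derivative `∂ⱼ φᵢ`. -/
def IsWeakJacobian (Ω : Set Plane) (φ : Plane → Plane) (G : Plane → Mat2) : Prop :=
  (∀ i j, IntegrableOn (fun x => G x i j) Ω) ∧
  ∀ η : Plane → ℝ, ContDiff ℝ 1 η → HasCompactSupport η → tsupport η ⊆ Ω →
    ∀ i j, ∫ x in Ω, φ x i * pderiv j η x = - ∫ x in Ω, G x i j * η x

/-- The Sobolev space `W^{1,1}(Ω, ℝ²)`. -/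
def W11 (Ω : Set Plane) : Set (Plane → Plane) :=
  {φ | IntegrableOn φ Ω ∧ ∃ G, IsWeakJacobian Ω φ G}

open Classical in
/-- The gradient (Jacobian matrix) `∇φ` of `φ ∈ W^{1,1}(Ω, ℝ²)`; it is determined almost everywhere
on `Ω`. -/
def weakJacobian (Ω : Set Plane) (φ : Plane → Plane) : Plane → Mat2 :=
  if h : ∃ G, IsWeakJacobian Ω φ G then h.choose else 0

/-- The admissible test fields for the total variation of a matrix field: compactly supported `C¹`
fields of `3`-tensors on `Ω` whose Frobenius norm is at most one everywhere. -/
def IsTestTensor (Ω : Set Plane) (ψ : Plane → Fin 2 → Fin 2 → Fin 2 → ℝ) : Prop :=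
  ContDiff ℝ 1 ψ ∧ HasCompactSupport ψ ∧ tsupport ψ ⊆ Ω ∧
    ∀ x, ∑ k, ∑ i, ∑ j, (ψ x k i j) ^ 2 ≤ 1

/-- The divergence of a field of `3`-tensors, with respect to the first index. -/
def divergence (ψ : Plane → Fin 2 → Fin 2 → Fin 2 → ℝ) (x : Plane) : Mat2 :=
  Matrix.of fun i j => ∑ k, pderiv k (fun y => ψ y k i j) x

/-- The total variation `TV(u)` on `Ω` of an integrable matrix field `u`. The supremum is
nonnegative because `ψ = 0` is admissible, so cutting off negative values does not change it. -/
def totalVariation (Ω : Set Plane) (u : Plane → Mat2) : ℝ≥0∞ :=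
  ⨆ (ψ : Plane → Fin 2 → Fin 2 → Fin 2 → ℝ) (_ : IsTestTensor Ω ψ),
    ENNReal.ofReal (∫ x in Ω, ∑ i, ∑ j, u x i j * divergence ψ x i j)

/-- The space `BV(Ω, ℝ^{2,2})`. -/
def BV (Ω : Set Plane) : Set (Plane → Mat2) :=
  {u | (∀ i j, IntegrableOn (fun x => u x i j) Ω) ∧ totalVariation Ω u < ⊤}

/-- The set `BV²(Ω, closure Ω₁)` of all `φ ∈ W^{1,1}(Ω, ℝ²)` with `∇φ ∈ BV(Ω, ℝ^{2,2})` and with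
values in the closure of `Ω₁` almost everywhere on `Ω`. -/
def BV2 (Ω Ω₁ : Set Plane) : Set (Plane → Plane) :=
  {φ | φ ∈ W11 Ω ∧ (∀ᵐ x ∂(volume.restrict Ω), φ x ∈ closure Ω₁) ∧ weakJacobian Ω φ ∈ BV Ω}

/-! ### The rotation part of a matrix -/

/-- A real `2 × 2` matrix of positive determinant has a unique polar decomposition `A = R V` with
`R` in `SO(2)` and `V` symmetric positive semidefinite. -/
theorem existsUnique_polar (A : Mat2) (hA : 0 < A.det) :
    ∃! R : SO2, ∃ V : Mat2, V.PosSemidef ∧ A = (R : Mat2) * V := by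
  obtain ⟨a, b, c, d, rfl⟩ : ∃ a b c d, A = !![a, b; c, d] := ⟨_, _, _, _, A.eta_fin_two⟩
  rw [Matrix.det_fin_two_of] at hA
  have hpos : 0 < (a + d) ^ 2 + (c - b) ^ 2 := by
    nlinarith [sq_nonneg (a - d), sq_nonneg (b + c)]
  obtain ⟨n, hn, hnn⟩ : ∃ n : ℝ, 0 < n ∧ n ^ 2 = (a + d) ^ 2 + (c - b) ^ 2 :=
    ⟨_, Real.sqrt_pos.2 hpos, Real.sq_sqrt hpos.le⟩
  have hn0 : n ≠ 0 := hn.ne'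
  refine ⟨⟨!![(a + d) / n, -((c - b) / n); (c - b) / n, (a + d) / n], ?_⟩, ?_, ?_⟩
  · rw [Matrix.of_mem_specialOrthogonalGroup_fin_two_iff]
    refine ⟨rfl, rfl, ?_⟩
    field_simp
    linarith
  · refine ⟨!![(a ^ 2 + c ^ 2 + (a * d - b * c)) / n, (a * b + c * d) / n;
      (a * b + c * d) / n, (b ^ 2 + d ^ 2 + (a * d - b * c)) / n], ?_, ?_⟩
    · refine Matrix.PosSemidef.of_dotProduct_mulVec_nonneg ?_ ?_
      · refine Matrix.IsHermitian.ext fun i j => ?_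
        fin_cases i <;> fin_cases j <;> rfl
      · intro x
        have h : 0 ≤ ((a * x 0 + b * x 1) ^ 2 + (c * x 0 + d * x 1) ^ 2
            + (a * d - b * c) * (x 0 ^ 2 + x 1 ^ 2)) / n := by positivity
        refine h.trans_eq ?_
        simp [dotProduct, Matrix.mulVec, Fin.sum_univ_two]
        field_simp
        ring
    · ext i j
      fin_cases i <;> fin_cases j <;> simp [Matrix.mul_apply, Fin.sum_univ_two] <;>
        field_simp <;> rw [hnn] <;> ring
  · rintro ⟨R, hR⟩ ⟨V, hV, hA'⟩
    obtain ⟨h1, h2, h3⟩ := Matrix.mem_specialOrthogonalGroup_fin_two_iff.1 hR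
    have hs : V 1 0 = V 0 1 := by simpa using hV.isHermitian.apply 0 1
    have ht : 0 ≤ V 0 0 + V 1 1 := add_nonneg hV.diag_nonneg hV.diag_nonneg
    have e00 := congrFun (congrFun hA' 0) 0
    have e01 := congrFun (congrFun hA' 0) 1
    have e10 := congrFun (congrFun hA' 1) 0
    have e11 := congrFun (congrFun hA' 1) 1
    simp only [Matrix.mul_apply, Fin.sum_univ_two, Matrix.of_apply, Matrix.cons_val',
      Matrix.cons_val_zero, Matrix.cons_val_one, Matrix.cons_val_fin_one] at e00 e01 e10 e11
    have hp : a + d = R 1 1 * (V 0 0 + V 1 1) := by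
      rw [e00, e11, h1, h2, hs]; ring
    have hq : c - b = R 1 0 * (V 0 0 + V 1 1) := by
      rw [e10, e01, h1, h2, hs]; ring
    have hnV : n = V 0 0 + V 1 1 := by
      rw [← sq_eq_sq₀ hn.le ht, hnn, hp, hq]
      rw [h1, h2] at h3
      linear_combination (V 0 0 + V 1 1) ^ 2 * h3
    apply Subtype.ext
    have hp' : (a + d) / n = R 1 1 := by rw [hp, ← hnV, mul_div_cancel_right₀ _ hn0]
    have hq' : (c - b) / n = R 1 0 := by rw [hq, ← hnV, mul_div_cancel_right₀ _ hn0]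
    ext i j
    fin_cases i <;> fin_cases j <;> simp [h1, h2, hp', hq']

/-- The rotation `R ∈ SO(2)` in the polar decomposition `A = R V` of a matrix of positive
determinant (and the identity for all other matrices). -/
def polarRotation (A : Mat2) : SO2 :=
  if h : 0 < A.det then (existsUnique_polar A h).choose else 1

/-- The rotation of space about the third axis that acts on the first two coordinates by `R`. -/
def aboutThirdAxis (R : SO2) : SO3 :=
  ⟨!![(R : Mat2) 0 0, (R : Mat2) 0 1, 0; (R : Mat2) 1 0, (R : Mat2) 1 1, 0; 0, 0, 1], by
    obtain ⟨h1, h2, h3⟩ := Matrix.mem_specialOrthogonalGroup_fin_two_iff.1 R.2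
    rw [h1, h2] at h3
    rw [Matrix.mem_specialOrthogonalGroup_iff, Matrix.mem_orthogonalGroup_iff]
    refine ⟨?_, ?_⟩
    · ext i j
      fin_cases i <;> fin_cases j <;>
        simp [Matrix.mul_apply, Fin.sum_univ_three, h1, h2] <;> linarith
    · simp [Matrix.det_fin_three, h1, h2]
      linarith⟩

/-! ### The distance on `SO(3)` modulo a finite group -/

/-- The geodesic distance on `SO(3)`. -/
def distSO3 (P Q : SO3) : ℝ :=
  √2 * Real.arccos (((((P : Matrix (Fin 3) (Fin 3) ℝ).transpose *
    (Q : Matrix (Fin 3) (Fin 3) ℝ)).trace) - 1) / 2)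

/-- The expression `min_{s ∈ S} d(P s, Q)`. -/
def minDist (S : Subgroup SO3) (P Q : SO3) : ℝ := ⨅ s : S, distSO3 (P * s) Q

/-- For a finite subgroup `S` the infimum in `minDist` is attained. -/
theorem exists_minDist_eq (S : Subgroup SO3) [Finite S] (P Q : SO3) :
    ∃ s : S, minDist S P Q = distSO3 (P * s) Q := by
  obtain ⟨s, hs⟩ := exists_eq_ciInf_of_finite (f := fun s : S => distSO3 (P * s) Q)
  exact ⟨s, hs.symm⟩

theorem distSO3_mul_right (P Q T : SO3) : distSO3 P (Q * T) = distSO3 (P * T⁻¹) Q := by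
  have h : ((T⁻¹ : SO3) : Matrix (Fin 3) (Fin 3) ℝ) = (T : Matrix (Fin 3) (Fin 3) ℝ).transpose := rfl
  simp only [distSO3, Submonoid.coe_mul, h, Matrix.transpose_mul, Matrix.transpose_transpose,
    ← Matrix.mul_assoc]
  rw [Matrix.trace_mul_comm, ← Matrix.mul_assoc]

/-- The minimum depends only on the cosets of `P` and `Q`. -/
theorem minDist_congr (S : Subgroup SO3) (P Q P' Q' : SO3)
    (hP : QuotientGroup.leftRel S P P') (hQ : QuotientGroup.leftRel S Q Q') :
    minDist S P Q = minDist S P' Q' := by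
  rw [QuotientGroup.leftRel_apply] at hP hQ
  obtain ⟨t, rfl⟩ : ∃ t : S, P' = P * t := ⟨⟨_, hP⟩, by simp⟩
  obtain ⟨u, rfl⟩ : ∃ u : S, Q' = Q * u := ⟨⟨_, hQ⟩, by simp⟩
  unfold minDist
  refine ((Equiv.mulLeft t).trans (Equiv.mulRight u⁻¹)).iInf_congr (fun s => ?_) |>.symm
  simp [distSO3_mul_right, mul_assoc]

/-- The distance `d([P], [Q]) = min_{s ∈ S} d(P s, Q)` on the cosets of the subgroup `S`. -/
def distMod (S : Subgroup SO3) (p q : SO3 ⧸ S) : ℝ :=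
  Quotient.liftOn₂' p q (minDist S) (minDist_congr S)

/-! ### The energy -/

/-- `f(t) = t⁻¹ + t` for `t > 0`, and `+∞` otherwise. -/
def detPenalty (t : ℝ) : ℝ≥0∞ := if 0 < t then ENNReal.ofReal (t⁻¹ + t) else ⊤

/-- The data term: the integral over `Ω` of the distance between `R(∇φ) I₁` and `I₂ ∘ φ`. -/
def dataTerm (Ω : Set Plane) (S : Subgroup SO3) (I₁ I₂ : Plane → SO3 ⧸ S)
    (φ : Plane → Plane) : ℝ≥0∞ :=
  ∫⁻ x in Ω, ENNReal.ofReal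
    (distMod S (aboutThirdAxis (polarRotation (weakJacobian Ω φ x)) • I₁ x) (I₂ (φ x)))

/-- The functional to be minimized, with values in `[0, ∞]`. -/
def energy (Ω : Set Plane) (S : Subgroup SO3) (I₁ I₂ : Plane → SO3 ⧸ S) (α β : ℝ)
    (φ : Plane → Plane) : ℝ≥0∞ :=
  dataTerm Ω S I₁ I₂ φ
    + ENNReal.ofReal α * totalVariation Ω (fun x => weakJacobian Ω φ x - 1)
    + ENNReal.ofReal β * ∫⁻ x in Ω, detPenalty (weakJacobian Ω φ x).det

end EBSDFlow

end

/-!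
The minimizer is found by the direct method. Along a minimizing sequence `φₙ`, the maps are
uniformly bounded because they take values in the bounded set `closure Ω₁`, and the total variations
of the gradients are bounded by the energy. What has to be shown is that a subsequence of
`(φₙ, ∇φₙ)` converges in `L¹(Ω)` and almost everywhere, and that each term of the energy is lower
semicontinuous under this convergence.

Compactness rests on one interpolation inequality. If all segments `x + [0, 1] v` with `x ∈ U` stay
in `Ω`, then for every test function `η` on `U`
`η = ∫₀¹ η(· - t v) dt + ∂ᵥ ∫₀¹ (1 - t) η(· - t v) dt`,
where both integrals are test functions on `Ω`. Testing `∂ᵥ u` against `η` therefore costs at most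
`2 ‖u‖₁` for the first integral, whose derivative along `v` is `η - η(· - v)`, plus the variation of
the gradient for the second; by duality this bounds `∂ᵥ u` in `L¹(U)`
(`HasWeakGrad.integral_abs_dir_le`). No mollification of `u` is needed. Near every point of its
closure, a Lipschitz domain contains with each of its points the segments of a fixed length starting
there in two linearly independent directions. Scaling these segments by `h` and using a finite cover
gives `‖∇u‖₁ ≤ D (‖u‖₁ / h + h C)` on the whole of `Ω`, where `C` bounds the variation of `∇u`
(`IsBoundedLipschitzDomain.exists_interpolation`). With `h = 1` this bounds `∇φₙ` in `L¹`, so that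
the `φₙ` are uniformly continuous in the mean and have a subsequence that is Cauchy in `L¹`
(`exists_cauchy_subseq`); applied to the differences `φₙ - φₘ` with small `h`, it shows that `∇φₙ`
is Cauchy in `L¹` as well (`IsBoundedLipschitzDomain.cauchy_grad`).

The total variation is a supremum of functionals continuous in `L¹`, and subtracting the constant
`Id` does not change it. The determinant penalty is lower semicontinuous, so Fatou's lemma applies;
it also shows that the limit has positive determinant almost everywhere. The rotation part of the
polar decomposition is continuous on matrices of positive determinant, so the integrands of the data
terms converge almost everywhere, and Fatou's lemma applies again (`exists_energy_le_liminf`). The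
infimum is finite since a map `x ↦ c + ε x` of `Ω` into a ball in `Ω₁` is admissible
(`exists_energy_lt_top`).
-/

noncomputable section

namespace EBSDFlow

/-! ### Test functions -/

/-- Scalar test functions on `Ω`: compactly supported `C¹` functions with support in `Ω`. -/
structure IsTest (Ω : Set Plane) (η : Plane → ℝ) : Prop where
  contDiff : ContDiff ℝ 1 η
  hasCompactSupport : HasCompactSupport η
  subset : tsupport η ⊆ Ω

theorem IsTest.neg {Ω : Set Plane} {η : Plane → ℝ} (h : IsTest Ω η) : IsTest Ω (fun x => -η x) := by
  refine ⟨h.1.neg, h.2.comp_left neg_zero, ?_⟩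
  refine (closure_mono fun x hx => ?_).trans h.3
  simpa using hx

theorem IsTest.continuous {Ω : Set Plane} {η : Plane → ℝ} (h : IsTest Ω η) : Continuous η :=
  h.1.continuous

theorem IsTest.continuous_fderiv {Ω : Set Plane} {η : Plane → ℝ} (h : IsTest Ω η) :
    Continuous (fderiv ℝ η) := h.1.continuous_fderiv one_ne_zero

theorem IsTest.continuous_pderiv {Ω : Set Plane} {η : Plane → ℝ} (h : IsTest Ω η) (j : Fin 2) :
    Continuous (pderiv j η) := h.continuous_fderiv.clm_apply continuous_const

theorem IsTest.exists_bound {Ω : Set Plane} {η : Plane → ℝ} (h : IsTest Ω η) :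
    ∃ C, ∀ x, |η x| ≤ C := by
  simpa using h.2.exists_bound_of_continuous h.continuous

theorem IsTest.exists_fderiv_bound {Ω : Set Plane} {η : Plane → ℝ} (h : IsTest Ω η) :
    ∃ C, ∀ x, ‖fderiv ℝ η x‖ ≤ C :=
  (h.2.fderiv (𝕜 := ℝ)).exists_bound_of_continuous h.continuous_fderiv

theorem IsTest.exists_pderiv_bound {Ω : Set Plane} {η : Plane → ℝ} (h : IsTest Ω η) (j : Fin 2) :
    ∃ C, ∀ x, |pderiv j η x| ≤ C := by
  have hc : HasCompactSupport (pderiv j η) :=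
    (h.2.fderiv (𝕜 := ℝ)).comp_left (g := fun L : Plane →L[ℝ] ℝ => L (EuclideanSpace.single j 1))
      (by simp)
  simpa using hc.exists_bound_of_continuous (h.continuous_pderiv j)

theorem IsTest.integrable_mul {Ω : Set Plane} {η u : Plane → ℝ} (h : IsTest Ω η)
    (hu : Integrable u) : Integrable (fun x => u x * η x) := by
  obtain ⟨C, hC⟩ := h.exists_bound
  exact hu.mul_bdd (c := C) h.continuous.aestronglyMeasurable
    (ae_of_all _ fun x => by simpa using hC x)

theorem IsTest.integrable_mul_pderiv {Ω : Set Plane} {η u : Plane → ℝ} (h : IsTest Ω η)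
    (hu : Integrable u) (j : Fin 2) : Integrable (fun x => u x * pderiv j η x) := by
  obtain ⟨C, hC⟩ := h.exists_pderiv_bound j
  exact hu.mul_bdd (c := C) (h.continuous_pderiv j).aestronglyMeasurable
    (ae_of_all _ fun x => by simpa using hC x)

theorem fderiv_apply_eq_sum (η : Plane → ℝ) (x v : Plane) :
    fderiv ℝ η x v = ∑ j, v j * pderiv j η x := by
  have hv : v = ∑ j, v j • EuclideanSpace.single j (1 : ℝ) := by
    ext i
    fin_cases i <;> simp [Fin.sum_univ_two]
  conv_lhs => rw [hv]
  simp [pderiv]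

/-! ### Averages along segments -/

/-- The weighted average of `η` over the segment from `x` to `x - v`. -/
def segAvg (w : ℝ → ℝ) (v : Plane) (η : Plane → ℝ) (x : Plane) : ℝ :=
  ∫ t in (0 : ℝ)..1, w t * η (x - t • v)

section segAvg

variable {w : ℝ → ℝ} {v : Plane} {Ω U : Set Plane} {η : Plane → ℝ}

theorem hasFDerivAt_segAvg (hw : Continuous w) (hη : IsTest U η) (x : Plane) :
    HasFDerivAt (segAvg w v η) (∫ t in (0 : ℝ)..1, w t • fderiv ℝ η (x - t • v)) x := by
  obtain ⟨C, hC⟩ := hη.exists_fderiv_bound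
  have hη' := hη.continuous
  have hηf := hη.continuous_fderiv
  refine (intervalIntegral.hasFDerivAt_integral_of_dominated_of_fderiv_le
    (F := fun x t => w t * η (x - t • v)) (F' := fun x t => w t • fderiv ℝ η (x - t • v))
    (bound := fun t => |w t| * C) Filter.univ_mem
    (Filter.Eventually.of_forall fun y => ?_) ?_ ?_ ?_ ?_ ?_)
  · exact Continuous.aestronglyMeasurable (by fun_prop)
  · exact Continuous.intervalIntegrable (by fun_prop) _ _
  · exact Continuous.aestronglyMeasurable (by fun_prop)
  · refine ae_of_all _ fun t _ y _ => ?_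
    rw [norm_smul, Real.norm_eq_abs]
    exact mul_le_mul_of_nonneg_left (hC _) (abs_nonneg _)
  · exact Continuous.intervalIntegrable (by fun_prop) _ _
  · refine ae_of_all _ fun t _ y _ => ?_
    have h1 : HasFDerivAt η (fderiv ℝ η (y - t • v)) (y - t • v) :=
      (hη.1.differentiable one_ne_zero _).hasFDerivAt
    have h2 : HasFDerivAt (fun z : Plane => z - t • v) (ContinuousLinearMap.id ℝ Plane) y :=
      (hasFDerivAt_id y).sub_const _
    exact (h1.comp y h2).const_mul (w t)

theorem contDiff_segAvg (hw : Continuous w) (hη : IsTest U η) : ContDiff ℝ 1 (segAvg w v η) := by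
  rw [contDiff_one_iff_fderiv]
  refine ⟨fun x => (hasFDerivAt_segAvg hw hη x).differentiableAt, ?_⟩
  have : fderiv ℝ (segAvg w v η) = fun x => ∫ t in (0 : ℝ)..1, w t • fderiv ℝ η (x - t • v) :=
    funext fun x => (hasFDerivAt_segAvg hw hη x).fderiv
  rw [this]
  have hηf := hη.continuous_fderiv
  exact intervalIntegral.continuous_parametric_intervalIntegral_of_continuous' (by fun_prop) _ _

/-- If all segments `x + [0, 1] v` with `x ∈ U` stay in `Ω`, the segment averages of a test function
on `U` are test functions on `Ω`. -/
theorem isTest_segAvg (hw : Continuous w) (hη : IsTest U η)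
    (hU : ∀ x ∈ U, ∀ t ∈ Icc (0 : ℝ) 1, x + t • v ∈ Ω) : IsTest Ω (segAvg w v η) := by
  set K : Set Plane := (fun p : Plane × ℝ => p.1 + p.2 • v) '' (tsupport η ×ˢ Icc (0 : ℝ) 1)
  have hK : IsCompact K :=
    (hη.2.isCompact.prod isCompact_Icc).image (by fun_prop)
  have h0 : ∀ x, x ∉ K → segAvg w v η x = 0 := by
    intro x hx
    refine (intervalIntegral.integral_congr (g := fun _ => (0 : ℝ)) fun t ht => ?_).trans (by simp)
    rw [uIcc_of_le zero_le_one] at ht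
    have : x - t • v ∉ tsupport η := fun h => hx ⟨(x - t • v, t), ⟨h, ht⟩, by simp⟩
    simp [image_eq_zero_of_notMem_tsupport this]
  refine ⟨contDiff_segAvg hw hη, HasCompactSupport.intro hK h0, ?_⟩
  refine (closure_minimal (fun x hx => ?_) hK.isClosed).trans (?_ : K ⊆ Ω)
  · by_contra h
    exact hx (h0 x h)
  · rintro _ ⟨⟨x, t⟩, ⟨hx, ht⟩, rfl⟩
    exact hU x (hη.3 hx) t ht

theorem abs_segAvg_le (hw : ∀ t ∈ Icc (0 : ℝ) 1, |w t| ≤ 1) (hη : ∀ x, |η x| ≤ 1) (x : Plane) :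
    |segAvg w v η x| ≤ 1 := by
  have := intervalIntegral.norm_integral_le_of_norm_le_const (a := (0 : ℝ)) (b := 1) (C := 1)
    (f := fun t => w t * η (x - t • v)) fun t ht => ?_
  · simpa [segAvg] using this
  · rw [uIoc_of_le zero_le_one] at ht
    rw [Real.norm_eq_abs, abs_mul]
    exact mul_le_one₀ (hw t ⟨ht.1.le, ht.2⟩) (abs_nonneg _) (hη _)

theorem fderiv_segAvg_apply (hw : Continuous w) (hη : IsTest U η) (x : Plane) :
    fderiv ℝ (segAvg w v η) x v = ∫ t in (0 : ℝ)..1, w t * fderiv ℝ η (x - t • v) v := by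
  have hηf := hη.continuous_fderiv
  rw [(hasFDerivAt_segAvg hw hη x).fderiv, ContinuousLinearMap.intervalIntegral_apply]
  · simp
  · exact Continuous.intervalIntegrable (by fun_prop) _ _

theorem hasDerivAt_along (hη : IsTest U η) (x : Plane) (t : ℝ) :
    HasDerivAt (fun t : ℝ => η (x - t • v)) (-(fderiv ℝ η (x - t • v) v)) t := by
  have h1 : HasFDerivAt η (fderiv ℝ η (x - t • v)) (x - t • v) :=
    (hη.1.differentiable one_ne_zero _).hasFDerivAt
  have h2 : HasDerivAt (fun t : ℝ => x - t • v) (-((1 : ℝ) • v)) t :=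
    ((hasDerivAt_id t).smul_const v).const_sub x
  have h3 := h1.comp_hasDerivAt t h2
  rw [one_smul, map_neg] at h3
  exact h3

theorem fderiv_segAvg_one (hη : IsTest U η) (x : Plane) :
    fderiv ℝ (segAvg (fun _ => 1) v η) x v = η x - η (x - v) := by
  have hηf := hη.continuous_fderiv
  rw [fderiv_segAvg_apply continuous_const hη]
  have := intervalIntegral.integral_eq_sub_of_hasDerivAt (a := (0 : ℝ)) (b := 1)
    (fun t _ => (hasDerivAt_along (v := v) hη x t).neg)
    (Continuous.intervalIntegrable (by fun_prop) _ _)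
  simp only [Pi.neg_apply, neg_neg, one_smul, zero_smul, sub_zero] at this
  simp only [one_mul]
  rw [this]
  ring

theorem fderiv_segAvg_one_sub (hη : IsTest U η) (x : Plane) :
    fderiv ℝ (segAvg (fun t => 1 - t) v η) x v = η x - segAvg (fun _ => 1) v η x := by
  have hηf := hη.continuous_fderiv
  have hηc := hη.continuous
  rw [fderiv_segAvg_apply (by fun_prop) hη]
  have hd : ∀ t : ℝ, HasDerivAt (fun t : ℝ => -((1 - t) * η (x - t • v)))
      (η (x - t • v) + (1 - t) * fderiv ℝ η (x - t • v) v) t := by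
    intro t
    have := (((hasDerivAt_id t).const_sub 1).mul (hasDerivAt_along (v := v) hη x t)).neg
    refine HasDerivAt.congr_deriv this ?_
    simp only [id_eq]
    ring
  have := intervalIntegral.integral_eq_sub_of_hasDerivAt (a := (0 : ℝ)) (b := 1)
    (fun t _ => hd t) (Continuous.intervalIntegrable (by fun_prop) _ _)
  rw [intervalIntegral.integral_add (Continuous.intervalIntegrable (by fun_prop) _ _)
    (Continuous.intervalIntegrable (by fun_prop) _ _)] at this
  simp only [segAvg, one_mul]
  simp at this
  linarith

end segAvg

/-! ### Duality for the `L¹` norm -/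

theorem exists_isTest_eq_one {U K : Set Plane} (hU : IsOpen U) (hK : IsCompact K) (hKU : K ⊆ U) :
    ∃ η, IsTest U η ∧ (∀ x, 0 ≤ η x ∧ η x ≤ 1) ∧ ∀ x ∈ K, η x = 1 := by
  obtain ⟨L, hL, hKL, hLU⟩ := exists_compact_between hK hU hKU
  obtain ⟨f, h0, h1, h01⟩ := exists_contMDiffMap_zero_one_of_isClosed (n := 1)
    (modelWithCornersSelf ℝ Plane) (s := (interior L)ᶜ) (t := K) isOpen_interior.isClosed_compl
    hK.isClosed (disjoint_left.2 fun x hx hxK => hx (hKL hxK))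
  have hz : ∀ x, x ∉ L → f x = 0 := fun x hx => h0 fun h => hx (interior_subset h)
  refine ⟨f, ⟨contMDiff_iff_contDiff.1 f.contMDiff, HasCompactSupport.intro hL hz, ?_⟩, ?_, ?_⟩
  · refine (closure_minimal (fun x hx => ?_) hL.isClosed).trans hLU
    by_contra h
    exact hx (hz x h)
  · exact fun x => ⟨(h01 x).1, (h01 x).2⟩
  · exact fun x hx => h1 hx

/-- The sign of an integrable function is approximated by test functions, up to a set on which the
function has small integral: the `L¹` norm on an open set is dual to the test functions bounded by
one. -/
theorem integral_abs_le_of_forall_isTest {U : Set Plane} (hU : IsOpen U) {f : Plane → ℝ}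
    (hf : IntegrableOn f U) {B : ℝ}
    (h : ∀ η, IsTest U η → (∀ x, |η x| ≤ 1) → ∫ x in U, f x * η x ≤ B) :
    ∫ x in U, |f x| ≤ B := by
  obtain ⟨g, hgm, hfg⟩ := hf.1
  have hg : Integrable g (volume.restrict U) := hf.congr hfg
  have habs : ∫ x in U, |f x| = ∫ x in U, |g x| :=
    integral_congr_ae (hfg.mono fun x hx => by simp only [hx])
  rw [habs]
  replace h : ∀ η, IsTest U η → (∀ x, |η x| ≤ 1) → ∫ x in U, g x * η x ≤ B := fun η h1 h2 =>
    (integral_congr_ae (hfg.mono fun x hx => by simp only [hx])).symm.trans_le (h η h1 h2)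
  set ν : Measure Plane := (volume.restrict U).withDensity (fun x => ‖g x‖ₑ) with hν
  have hfin : IsFiniteMeasure ν := isFiniteMeasure_withDensity hg.2.ne
  refine le_of_forall_pos_le_add fun ε hε => ?_
  have hε4 : ENNReal.ofReal (ε / 4) ≠ 0 := by simpa using hε
  have hP : MeasurableSet (U ∩ {x | 0 < g x}) :=
    hU.measurableSet.inter (measurableSet_lt measurable_const hgm.measurable)
  have hN : MeasurableSet (U ∩ {x | g x < 0}) :=
    hU.measurableSet.inter (measurableSet_lt hgm.measurable measurable_const)
  obtain ⟨K₁, hK₁P, hK₁, hν₁⟩ := hP.exists_isCompact_sdiff_lt (μ := ν) (measure_ne_top _ _) hε4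
  obtain ⟨K₂, hK₂N, hK₂, hν₂⟩ := hN.exists_isCompact_sdiff_lt (μ := ν) (measure_ne_top _ _) hε4
  have hdisj : Disjoint K₁ K₂ := disjoint_left.2 fun x h1 h2 =>
    lt_asymm (show 0 < g x from (hK₁P h1).2) (hK₂N h2).2
  -- disjoint supports keep the difference of the two cut-off functions bounded by one
  obtain ⟨V₁, V₂, hV₁, hV₂, hKV₁, hKV₂, hV⟩ :=
    SeparatedNhds.of_isCompact_isCompact hK₁ hK₂ hdisj
  obtain ⟨η₁, ht₁, hb₁, ho₁⟩ := exists_isTest_eq_one (hU.inter hV₁) hK₁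
    (subset_inter (hK₁P.trans inter_subset_left) hKV₁)
  obtain ⟨η₂, ht₂, hb₂, ho₂⟩ := exists_isTest_eq_one (hU.inter hV₂) hK₂
    (subset_inter (hK₂N.trans inter_subset_left) hKV₂)
  have hz₁ : ∀ x, x ∉ V₁ → η₁ x = 0 := fun x hx =>
    image_eq_zero_of_notMem_tsupport fun h => hx (ht₁.3 h).2
  have hz₂ : ∀ x, x ∉ V₂ → η₂ x = 0 := fun x hx =>
    image_eq_zero_of_notMem_tsupport fun h => hx (ht₂.3 h).2
  set E : Set Plane := ((U ∩ {x | 0 < g x}) \ K₁) ∪ ((U ∩ {x | g x < 0}) \ K₂) with hE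
  have hEm : MeasurableSet E := (hP.diff hK₁.measurableSet).union (hN.diff hK₂.measurableSet)
  have hνE : ν E ≤ ENNReal.ofReal (ε / 2) := by
    refine (measure_union_le _ _).trans ((add_le_add hν₁.le hν₂.le).trans ?_)
    rw [← ENNReal.ofReal_add (by positivity) (by positivity)]
    exact ENNReal.ofReal_le_ofReal (by linarith)
  have hEint : ∫ x in U, E.indicator (fun x => |g x|) x ≤ ε / 2 := by
    rw [integral_indicator hEm]
    have e1 := integral_norm_eq_lintegral_enorm (μ := (volume.restrict U).restrict E)
      hg.restrict.1
    simp only [Real.norm_eq_abs] at e1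
    rw [e1, ← withDensity_apply _ hEm]
    exact ENNReal.toReal_le_of_le_ofReal (by positivity) hνE
  have hη : IsTest U (fun x => η₁ x - η₂ x) := by
    refine ⟨ht₁.1.sub ht₂.1, ht₁.2.sub ht₂.2, ?_⟩
    refine (tsupport_sub _ _).trans (union_subset (ht₁.3.trans inter_subset_left)
      (ht₂.3.trans inter_subset_left))
  have hη1 : ∀ x, |η₁ x - η₂ x| ≤ 1 := fun x => by
    have := hb₁ x
    have := hb₂ x
    rw [abs_le]
    constructor <;> linarith
  have hpt : ∀ x ∈ U, |g x| ≤ g x * (η₁ x - η₂ x) + 2 * E.indicator (fun x => |g x|) x := by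
    intro x hx
    by_cases hxE : x ∈ E
    · rw [indicator_of_mem hxE]
      have h1 : |g x * (η₁ x - η₂ x)| ≤ |g x| := by
        rw [abs_mul]
        exact mul_le_of_le_one_right (abs_nonneg _) (hη1 x)
      have := neg_abs_le (g x * (η₁ x - η₂ x))
      linarith
    · rw [indicator_of_notMem hxE, mul_zero, add_zero]
      rcases lt_trichotomy (g x) 0 with hgx | hgx | hgx
      · have hxK : x ∈ K₂ := by
          by_contra hc
          exact hxE (Or.inr ⟨⟨hx, hgx⟩, hc⟩)
        rw [ho₂ x hxK, hz₁ x (fun hc => disjoint_left.1 hV hc (hKV₂ hxK)), abs_of_neg hgx]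
        linarith
      · simp [hgx]
      · have hxK : x ∈ K₁ := by
          by_contra hc
          exact hxE (Or.inl ⟨⟨hx, hgx⟩, hc⟩)
        rw [ho₁ x hxK, hz₂ x (fun hc => disjoint_left.1 hV (hKV₁ hxK) hc), abs_of_pos hgx]
        linarith
  have hi1 : Integrable (fun x => g x * (η₁ x - η₂ x)) (volume.restrict U) := by
    refine hg.mul_bdd (c := 1) hη.continuous.aestronglyMeasurable (ae_of_all _ fun x => ?_)
    simpa using hη1 x
  have hi2 : Integrable (E.indicator (fun x => |g x|)) (volume.restrict U) := hg.abs.indicator hEm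
  calc ∫ x in U, |g x| ≤ ∫ x in U, (g x * (η₁ x - η₂ x) + 2 * E.indicator (fun x => |g x|) x) := by
        refine setIntegral_mono_on hg.abs (hi1.add (hi2.const_mul 2)) hU.measurableSet hpt
    _ = (∫ x in U, g x * (η₁ x - η₂ x)) + 2 * ∫ x in U, E.indicator (fun x => |g x|) x := by
        rw [integral_add hi1 (hi2.const_mul 2), integral_const_mul]
    _ ≤ B + ε := by linarith [h _ hη hη1]

/-! ### Scalar functions with a weak gradient of bounded variation -/

/-- `u` and `g 0`, `g 1` are integrable on the plane, and `g j` is the weak partial derivative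
`∂ⱼ u` on `Ω`. Functions on `Ω` enter through their extension by zero. -/
structure HasWeakGrad (Ω : Set Plane) (u : Plane → ℝ) (g : Fin 2 → Plane → ℝ) : Prop where
  integrable : Integrable u
  integrable_grad : ∀ j, Integrable (g j)
  integral_eq : ∀ η, IsTest Ω η → ∀ j, ∫ x, u x * pderiv j η x = -∫ x, g j x * η x

/-- The distributional derivatives of `g` on `Ω` have total mass at most `C`, coordinate by
coordinate. -/
def VarBound (Ω : Set Plane) (g : Plane → ℝ) (C : ℝ) : Prop :=
  ∀ η, IsTest Ω η → (∀ x, |η x| ≤ 1) → ∀ j, |∫ x, g x * pderiv j η x| ≤ C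

theorem VarBound.nonneg {Ω : Set Plane} {g : Plane → ℝ} {C : ℝ} (h : VarBound Ω g C) : 0 ≤ C := by
  refine (abs_nonneg _).trans (h (fun _ => 0) ⟨contDiff_const, HasCompactSupport.zero, ?_⟩ ?_ 0)
  · have : (fun _ : Plane => (0 : ℝ)) = 0 := rfl
    rw [this, tsupport_zero]
    exact empty_subset _
  · simp

theorem HasWeakGrad.sub {Ω : Set Plane} {u u' : Plane → ℝ} {g g' : Fin 2 → Plane → ℝ}
    (h : HasWeakGrad Ω u g) (h' : HasWeakGrad Ω u' g') :
    HasWeakGrad Ω (fun x => u x - u' x) (fun j x => g j x - g' j x) := by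
  refine ⟨h.1.sub h'.1, fun j => (h.2 j).sub (h'.2 j), fun η hη j => ?_⟩
  simp only [sub_mul]
  rw [integral_sub (hη.integrable_mul_pderiv h.1 j) (hη.integrable_mul_pderiv h'.1 j),
    integral_sub (hη.integrable_mul (h.2 j)) (hη.integrable_mul (h'.2 j)), h.3 η hη j, h'.3 η hη j]
  ring

theorem VarBound.sub {Ω : Set Plane} {g g' : Plane → ℝ} {C C' : ℝ} (h : VarBound Ω g C)
    (h' : VarBound Ω g' C') (hg : Integrable g) (hg' : Integrable g') :
    VarBound Ω (fun x => g x - g' x) (C + C') := by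
  intro η hη h1 j
  simp only [sub_mul]
  rw [integral_sub (hη.integrable_mul_pderiv hg j) (hη.integrable_mul_pderiv hg' j)]
  exact (abs_sub _ _).trans (add_le_add (h η hη h1 j) (h' η hη h1 j))

theorem abs_integral_mul_le {μ : Measure Plane} {f η : Plane → ℝ} (hf : Integrable f μ) {c : ℝ}
    (hη : ∀ x, |η x| ≤ c) : |∫ x, f x * η x ∂μ| ≤ c * ∫ x, |f x| ∂μ := by
  rw [← integral_const_mul]
  refine abs_integral_le_integral_abs.trans ?_
  refine integral_mono_of_nonneg (ae_of_all _ fun x => abs_nonneg _) (hf.abs.const_mul c)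
    (ae_of_all _ fun x => ?_)
  simp only [abs_mul]
  rw [mul_comm]
  exact mul_le_mul_of_nonneg_right (hη x) (abs_nonneg _)

theorem IsTest.setIntegral_mul {U : Set Plane} {η : Plane → ℝ} (hη : IsTest U η) (f : Plane → ℝ) :
    ∫ x in U, f x * η x = ∫ x, f x * η x := by
  refine setIntegral_eq_integral_of_forall_compl_eq_zero fun x hx => ?_
  rw [image_eq_zero_of_notMem_tsupport fun h => hx (hη.3 h), mul_zero]

theorem IsTest.setIntegral_mul_pderiv {U : Set Plane} {η : Plane → ℝ} (hη : IsTest U η)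
    (f : Plane → ℝ) (j : Fin 2) :
    ∫ x in U, f x * pderiv j η x = ∫ x, f x * pderiv j η x := by
  refine setIntegral_eq_integral_of_forall_compl_eq_zero fun x hx => ?_
  have : x ∉ tsupport (fderiv ℝ η) := fun h => hx (hη.3 (tsupport_fderiv_subset ℝ h))
  rw [pderiv, image_eq_zero_of_notMem_tsupport this]
  simp

section estimates

variable {Ω U : Set Plane} {u : Plane → ℝ} {g : Fin 2 → Plane → ℝ} {v : Plane}

/-- Integration by parts in the direction `v` against a segment average. -/
theorem HasWeakGrad.integral_mul_segAvg (h : HasWeakGrad Ω u g) {η : Plane → ℝ} (hη : IsTest U η)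
    (hUv : ∀ x ∈ U, ∀ t ∈ Icc (0 : ℝ) 1, x + t • v ∈ Ω) :
    ∑ j, v j * ∫ x, g j x * segAvg (fun _ => 1) v η x = -∫ x, u x * (η x - η (x - v)) := by
  have hΨ : IsTest Ω (segAvg (fun _ => 1) v η) := isTest_segAvg continuous_const hη hUv
  have e : ∀ x, u x * (η x - η (x - v)) =
      ∑ j, v j * (u x * pderiv j (segAvg (fun _ => 1) v η) x) := fun x => by
    rw [← fderiv_segAvg_one hη x, fderiv_apply_eq_sum, Finset.mul_sum]
    exact Finset.sum_congr rfl fun j _ => by ring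
  simp only [e]
  rw [integral_finsetSum _ fun j _ => (hΨ.integrable_mul_pderiv h.1 j).const_mul _,
    ← Finset.sum_neg_distrib]
  refine Finset.sum_congr rfl fun j _ => ?_
  rw [integral_const_mul, h.3 _ hΨ j]
  ring

/-- Interpolation between `u` and its second derivatives: since
`η = ∫₀¹ η(· - tv) dt + ∂ᵥ ∫₀¹ (1 - t) η(· - tv) dt`, the derivative `∂ᵥ u` tested against `η` is
controlled by the difference `u(· + v) - u` and by the variation of the gradient. -/
theorem HasWeakGrad.integral_abs_dir_le (hU : IsOpen U) (h : HasWeakGrad Ω u g) {C : ℝ}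
    (hC : ∀ j, VarBound Ω (g j) C) (hUv : ∀ x ∈ U, ∀ t ∈ Icc (0 : ℝ) 1, x + t • v ∈ Ω) :
    ∫ x in U, |∑ j, v j * g j x| ≤ 2 * (∫ x, |u x|) + (∑ j, |v j|) ^ 2 * C := by
  have hint : Integrable (fun x => ∑ j, v j * g j x) :=
    integrable_finsetSum _ fun j _ => (h.2 j).const_mul _
  refine integral_abs_le_of_forall_isTest hU hint.integrableOn fun η hη h1 => ?_
  rw [hη.setIntegral_mul]
  have hΨ : IsTest Ω (segAvg (fun _ => 1) v η) := isTest_segAvg continuous_const hη hUv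
  have hΞ : IsTest Ω (segAvg (fun t => 1 - t) v η) := isTest_segAvg (by fun_prop) hη hUv
  have hΞ1 : ∀ x, |segAvg (fun t => 1 - t) v η x| ≤ 1 := abs_segAvg_le (fun t ht => by
    rw [abs_of_nonneg (sub_nonneg.2 ht.2)]; linarith [ht.1]) h1
  have e : ∀ x, (∑ j, v j * g j x) * η x =
      (∑ j, v j * (g j x * segAvg (fun _ => 1) v η x)) +
      ∑ j, ∑ k, v j * v k * (g j x * pderiv k (segAvg (fun t => 1 - t) v η) x) := fun x => by
    have e1 : η x = segAvg (fun _ => 1) v η x +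
        ∑ k, v k * pderiv k (segAvg (fun t => 1 - t) v η) x := by
      rw [← fderiv_apply_eq_sum, fderiv_segAvg_one_sub hη]
      ring
    conv_lhs => rw [e1]
    simp only [Fin.sum_univ_two]
    ring
  simp only [e]
  have i1 : ∀ j, Integrable (fun x => v j * (g j x * segAvg (fun _ => 1) v η x)) := fun j =>
    (hΨ.integrable_mul (h.2 j)).const_mul _
  have i2 : ∀ j k, Integrable
      (fun x => v j * v k * (g j x * pderiv k (segAvg (fun t => 1 - t) v η) x)) := fun j k =>
    (hΞ.integrable_mul_pderiv (h.2 j) k).const_mul _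
  rw [integral_add (integrable_finsetSum _ fun j _ => i1 j)
    (integrable_finsetSum _ fun j _ => integrable_finsetSum _ fun k _ => i2 j k),
    integral_finsetSum _ fun j _ => i1 j,
    integral_finsetSum _ fun j _ => integrable_finsetSum _ fun k _ => i2 j k]
  refine add_le_add ?_ ?_
  · simp only [integral_const_mul]
    rw [h.integral_mul_segAvg hη hUv]
    refine (neg_le_abs _).trans (abs_integral_mul_le h.1 fun x => ?_)
    have := (abs_sub (η x) (η (x - v)))
    linarith [h1 x, h1 (x - v)]
  · have e2 : (∑ j, |v j|) ^ 2 * C = ∑ j, ∑ k, |v j| * |v k| * C := by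
      simp only [Fin.sum_univ_two]
      ring
    rw [e2]
    refine Finset.sum_le_sum fun j _ => ?_
    rw [integral_finsetSum _ fun k _ => i2 j k]
    refine Finset.sum_le_sum fun k _ => ?_
    rw [integral_const_mul]
    refine (le_abs_self _).trans ?_
    rw [abs_mul, abs_mul]
    exact mul_le_mul_of_nonneg_left (hC j _ hΞ hΞ1 k) (by positivity)

/-- The `L¹` modulus of continuity of a function with integrable weak gradient. -/
theorem HasWeakGrad.integral_abs_translate_le (hU : IsOpen U) (h : HasWeakGrad Ω u g)
    (hUv : ∀ x ∈ U, ∀ t ∈ Icc (0 : ℝ) 1, x + t • v ∈ Ω) :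
    ∫ x in U, |u (x + v) - u x| ≤ ∑ j, |v j| * ∫ x in Ω, |g j x| := by
  have hint : Integrable (fun x => u (x + v) - u x) := (h.1.comp_add_right v).sub h.1
  refine integral_abs_le_of_forall_isTest hU hint.integrableOn fun η hη h1 => ?_
  rw [hη.setIntegral_mul]
  have hΨ : IsTest Ω (segAvg (fun _ => 1) v η) := isTest_segAvg continuous_const hη hUv
  have hΨ1 : ∀ x, |segAvg (fun _ => 1) v η x| ≤ 1 := abs_segAvg_le (fun t _ => by simp) h1
  have hb : ∀ᵐ x, ‖η (x - v)‖ ≤ 1 := ae_of_all _ fun x => by simpa using h1 (x - v)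
  have i1 : Integrable (fun x => u x * η (x - v)) := h.1.mul_bdd (c := 1)
    (hη.continuous.comp (continuous_id.sub continuous_const)).aestronglyMeasurable hb
  have e1 : ∫ x, u (x + v) * η x = ∫ x, u x * η (x - v) := by
    rw [← integral_add_right_eq_self (fun x => u x * η (x - v)) v]
    simp
  have e2 : ∫ x, (u (x + v) - u x) * η x = -∫ x, u x * (η x - η (x - v)) := by
    simp only [sub_mul, mul_sub]
    rw [integral_sub (hη.integrable_mul (h.1.comp_add_right v)) (hη.integrable_mul h.1),
      integral_sub (hη.integrable_mul h.1) i1, e1]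
    ring
  rw [e2, ← h.integral_mul_segAvg hη hUv]
  refine Finset.sum_le_sum fun j _ => (le_abs_self _).trans ?_
  rw [abs_mul, ← hΨ.setIntegral_mul]
  refine mul_le_mul_of_nonneg_left ?_ (abs_nonneg _)
  refine abs_integral_le_integral_abs.trans ?_
  refine integral_mono_of_nonneg (ae_of_all _ fun x => abs_nonneg _) (h.2 j).abs.integrableOn
    (ae_of_all _ fun x => ?_)
  simp only [abs_mul]
  exact mul_le_of_le_one_right (abs_nonneg _) (hΨ1 x)

end estimates

/-! ### Interior cones of a Lipschitz domain -/

/-- A linear form on the plane is controlled by its values on two spanning vectors. -/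
theorem abs_le_of_spanning {v : Fin 2 → Plane}
    (hv : ∀ z : Plane, ∃ c : Fin 2 → ℝ, z = ∑ i, c i • v i) :
    ∃ D : ℝ, 0 ≤ D ∧ ∀ (a : Fin 2 → ℝ) (j : Fin 2), |a j| ≤ D * ∑ i, |∑ k, v i k * a k| := by
  choose c hc using fun j : Fin 2 => hv (EuclideanSpace.single j 1)
  refine ⟨∑ j, ∑ i, |c j i|, by positivity, fun a j => ?_⟩
  have e : a j = ∑ i, c j i * ∑ k, v i k * a k := by
    have h0 := congrArg (fun z : Plane => z 0) (hc j)
    have h1 := congrArg (fun z : Plane => z 1) (hc j)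
    simp only [Fin.sum_univ_two, PiLp.add_apply, PiLp.smul_apply, smul_eq_mul] at h0 h1 ⊢
    have : a j = (EuclideanSpace.single j (1 : ℝ) : Plane) 0 * a 0
        + (EuclideanSpace.single j (1 : ℝ) : Plane) 1 * a 1 := by
      fin_cases j <;> simp
    rw [this, h0, h1]
    ring
  rw [e, Finset.mul_sum]
  refine (Finset.abs_sum_le_sum_abs _ _).trans (Finset.sum_le_sum fun i _ => ?_)
  rw [abs_mul]
  refine mul_le_mul_of_nonneg_right ?_ (abs_nonneg _)
  refine (Finset.single_le_sum (f := fun i => |c j i|) (fun i _ => abs_nonneg _)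
    (Finset.mem_univ i)).trans ?_
  exact Finset.single_le_sum (f := fun j => ∑ i, |c j i|) (fun j _ => by positivity)
    (Finset.mem_univ j)

/-- Near each point of its closure, a Lipschitz domain contains with each of its points `x` the
segments `x + [0, 1] vᵢ`, for two spanning vectors `vᵢ` that do not depend on `x`. -/
theorem IsBoundedLipschitzDomain.exists_segments {Ω : Set Plane} (hΩ : IsBoundedLipschitzDomain Ω)
    {p : Plane} (hp : p ∈ closure Ω) :
    ∃ r : ℝ, 0 < r ∧ ∃ v : Fin 2 → Plane,
      (∀ z : Plane, ∃ c : Fin 2 → ℝ, z = ∑ i, c i • v i) ∧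
      ∀ i, ∀ x ∈ Metric.ball p r ∩ Ω, ∀ t ∈ Icc (0 : ℝ) 1, x + t • v i ∈ Ω := by
  by_cases hpΩ : p ∈ Ω
  · obtain ⟨r, hr, hb⟩ := Metric.isOpen_iff.1 hΩ.isOpen p hpΩ
    refine ⟨r / 2, by positivity, fun i => EuclideanSpace.single i (r / 2), fun z => ?_, ?_⟩
    · refine ⟨fun i => z i / (r / 2), ?_⟩
      ext i
      have : r ≠ 0 := hr.ne'
      fin_cases i <;> simp [Fin.sum_univ_two] <;> field_simp
    · intro i x hx t ht
      refine hb ?_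
      rw [Metric.mem_ball, dist_eq_norm]
      have h1 : ‖x - p‖ < r / 2 := by simpa [dist_eq_norm] using hx.1
      have h2 : ‖t • (EuclideanSpace.single i (r / 2) : Plane)‖ ≤ r / 2 := by
        rw [norm_smul, PiLp.norm_single, Real.norm_eq_abs, Real.norm_eq_abs,
          abs_of_nonneg ht.1, abs_of_pos (by positivity)]
        exact mul_le_of_le_one_left (by positivity) ht.2
      calc ‖x + t • (EuclideanSpace.single i (r / 2) : Plane) - p‖
          = ‖(x - p) + t • (EuclideanSpace.single i (r / 2) : Plane)‖ := by congr 1; abel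
        _ ≤ _ := norm_add_le _ _
        _ < r := by linarith
  · have hpf : p ∈ frontier Ω := by
      rw [frontier, hΩ.isOpen.interior_eq]
      exact ⟨hp, hpΩ⟩
    obtain ⟨r, hr, T, K, g, hg, hx⟩ := hΩ.lipschitz p hpf
    -- in graph coordinates, the directions `(± a, 1)` with `a = 1 / (K + 1)` lie in the open cone
    -- above the graph
    set a : ℝ := 1 / (K + 1) with ha
    have hK : (0 : ℝ) ≤ K := K.2
    have ha0 : 0 < a := by positivity
    have haK : K * a < 1 := by
      rw [ha, mul_one_div, div_lt_one (by positivity)]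
      linarith
    have ha1 : a ≤ 1 := by
      rw [ha, div_le_one (by positivity)]
      linarith
    set s : Fin 2 → ℝ := ![1, -1] with hs
    have hs1 : ∀ i, |s i| = 1 := by
      intro i
      fin_cases i <;> simp [hs]
    set w : Fin 2 → Plane := fun i => !₂[s i * a, 1] with hw
    have hwn : ∀ i, ‖w i‖ ≤ 2 := by
      intro i
      rw [EuclideanSpace.norm_eq, Real.sqrt_le_left (by norm_num)]
      simp only [hw, Fin.sum_univ_two, Real.norm_eq_abs, sq_abs]
      simp only [Matrix.cons_val_zero, Matrix.cons_val_one]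
      have : s i ^ 2 = 1 := by rw [← sq_abs, hs1]; norm_num
      rw [mul_pow, this]
      nlinarith
    refine ⟨r / 2, by positivity, fun i => T.symm ((r / 4) • w i), fun z => ?_, ?_⟩
    · refine ⟨![(T z 0 / a + T z 1) / 2 / (r / 4), (T z 1 - T z 0 / a) / 2 / (r / 4)], ?_⟩
      apply T.injective
      have : r ≠ 0 := hr.ne'
      have : a ≠ 0 := ha0.ne'
      rw [map_sum]
      simp only [map_smul, T.apply_symm_apply]
      ext i
      fin_cases i <;> simp [Fin.sum_univ_two, hw, hs] <;> field_simp <;> ring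
    · rintro i x ⟨hxb, hxΩ⟩ t ht
      have hxr : ‖x - p‖ < r / 2 := by simpa [dist_eq_norm] using hxb
      have hb1 : x ∈ Metric.ball p r := by
        rw [Metric.mem_ball, dist_eq_norm]
        linarith
      have hb2 : x + t • T.symm ((r / 4) • w i) ∈ Metric.ball p r := by
        rw [Metric.mem_ball, dist_eq_norm]
        have h2 : ‖t • T.symm ((r / 4) • w i)‖ ≤ r / 2 := by
          rw [norm_smul, T.symm.norm_map, norm_smul, Real.norm_eq_abs, Real.norm_eq_abs,
            abs_of_nonneg ht.1, abs_of_pos (by positivity)]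
          have := hwn i
          have := norm_nonneg (w i)
          calc t * (r / 4 * ‖w i‖) ≤ 1 * (r / 4 * ‖w i‖) :=
                mul_le_mul_of_nonneg_right ht.2 (by positivity)
            _ ≤ r / 2 := by nlinarith
        calc ‖x + t • T.symm ((r / 4) • w i) - p‖
            = ‖(x - p) + t • T.symm ((r / 4) • w i)‖ := by congr 1; abel
          _ ≤ _ := norm_add_le _ _
          _ < r := by linarith
      rw [hx _ hb2]
      have hlt := (hx x hb1).1 hxΩ
      simp only [map_add, map_smul, T.apply_symm_apply, PiLp.add_apply, PiLp.smul_apply,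
        smul_eq_mul, hw]
      simp only [Matrix.cons_val_zero, Matrix.cons_val_one, mul_one]
      have hl := hg.dist_le_mul (T x 0 + t * (r / 4 * (s i * a))) (T x 0)
      rw [Real.dist_eq, Real.dist_eq, add_sub_cancel_left, abs_mul, abs_mul, abs_mul, hs1,
        abs_of_nonneg ht.1, abs_of_pos ha0, abs_of_pos (by positivity : 0 < r / 4)] at hl
      have h3 := (le_abs_self _).trans hl
      have h4 : (K : ℝ) * (t * (r / 4 * (1 * a))) ≤ t * (r / 4) := by
        have : 0 ≤ t * (r / 4) := mul_nonneg ht.1 (by positivity)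
        nlinarith
      linarith

/-- On a bounded Lipschitz domain the gradient in `L¹` is interpolated between the function in `L¹`
and the variation of the gradient. -/
theorem IsBoundedLipschitzDomain.exists_interpolation {Ω : Set Plane}
    (hΩ : IsBoundedLipschitzDomain Ω) :
    ∃ D : ℝ, 0 ≤ D ∧ ∀ (u : Plane → ℝ) (g : Fin 2 → Plane → ℝ) (C : ℝ), HasWeakGrad Ω u g →
      (∀ j, VarBound Ω (g j) C) → ∀ h : ℝ, 0 < h → h ≤ 1 → ∀ j,
        ∫ x in Ω, |g j x| ≤ D * ((∫ x, |u x|) / h + h * C) := by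
  choose! r hr v hspan hseg using fun p hp => hΩ.exists_segments (p := p) hp
  choose! D hD0 hD using fun p hp => abs_le_of_spanning (hspan p hp)
  have hcomp : IsCompact (closure Ω) := hΩ.isBounded.isCompact_closure
  obtain ⟨t, htΩ, ht⟩ := hcomp.elim_nhds_subcover (fun p => Metric.ball p (r p))
    fun p hp => Metric.ball_mem_nhds p (hr p hp)
  refine ⟨∑ p ∈ t, D p * ∑ i, (2 + (∑ k, |v p i k|) ^ 2),
    Finset.sum_nonneg fun p hp => mul_nonneg (hD0 p (htΩ p hp)) (by positivity),
    fun u g C hu hC h h0 h1 j => ?_⟩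
  have hC0 : 0 ≤ C := (hC 0).nonneg
  have hu0 : 0 ≤ ∫ x, |u x| := integral_nonneg fun x => abs_nonneg _
  have hUo : ∀ p, IsOpen (Metric.ball p (r p) ∩ Ω) := fun p => Metric.isOpen_ball.inter hΩ.isOpen
  have hloc : ∀ p ∈ t, ∫ x in Metric.ball p (r p) ∩ Ω, |g j x| ≤
      (D p * ∑ i, (2 + (∑ k, |v p i k|) ^ 2)) * ((∫ x, |u x|) / h + h * C) := by
    intro p hp
    have hpc := htΩ p hp
    have hdir : ∀ i, ∫ x in Metric.ball p (r p) ∩ Ω, |∑ k, v p i k * g k x| ≤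
        (2 + (∑ k, |v p i k|) ^ 2) * ((∫ x, |u x|) / h + h * C) := by
      intro i
      -- scaling the segment by `h` and dividing by `h` gives the two powers of `h`
      have key := hu.integral_abs_dir_le (v := h • v p i) (hUo p) hC fun x hx τ hτ => by
        rw [smul_smul]
        exact hseg p hpc i x hx _ ⟨mul_nonneg hτ.1 h0.le, mul_le_one₀ hτ.2 h0.le h1⟩
      have e1 : ∀ x, |∑ k, (h • v p i) k * g k x| = h * |∑ k, v p i k * g k x| := fun x => by
        have : ∑ k, (h • v p i) k * g k x = h * ∑ k, v p i k * g k x := by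
          rw [Finset.mul_sum]
          exact Finset.sum_congr rfl fun k _ => by simp [mul_assoc]
        rw [this, abs_mul, abs_of_pos h0]
      have e2 : ∑ k, |(h • v p i) k| = h * ∑ k, |v p i k| := by
        rw [Finset.mul_sum]
        exact Finset.sum_congr rfl fun k _ => by simp [abs_mul, abs_of_pos h0]
      simp only [e1] at key
      rw [integral_const_mul, e2] at key
      have : ∫ x in Metric.ball p (r p) ∩ Ω, |∑ k, v p i k * g k x| ≤
          2 * ((∫ x, |u x|) / h) + (∑ k, |v p i k|) ^ 2 * (h * C) := by
        refine le_of_mul_le_mul_left (key.trans_eq ?_) h0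
        field_simp
      refine this.trans ?_
      have a1 : 0 ≤ (∫ x, |u x|) / h := by positivity
      have a2 : 0 ≤ h * C := by positivity
      have a3 : 0 ≤ (∑ k, |v p i k|) ^ 2 := by positivity
      nlinarith
    have hi : ∀ i, Integrable (fun x => |∑ k, v p i k * g k x|)
        (volume.restrict (Metric.ball p (r p) ∩ Ω)) := fun i =>
      (integrable_finsetSum _ fun k _ => (hu.2 k).const_mul _).abs.integrableOn
    calc ∫ x in Metric.ball p (r p) ∩ Ω, |g j x|
        ≤ ∫ x in Metric.ball p (r p) ∩ Ω, D p * ∑ i, |∑ k, v p i k * g k x| :=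
          integral_mono (hu.2 j).abs.integrableOn
            ((integrable_finsetSum _ fun i _ => hi i).const_mul _)
            fun x => hD p hpc (fun k => g k x) j
      _ = D p * ∑ i, ∫ x in Metric.ball p (r p) ∩ Ω, |∑ k, v p i k * g k x| := by
          rw [integral_const_mul, integral_finsetSum _ fun i _ => hi i]
      _ ≤ D p * ∑ i, (2 + (∑ k, |v p i k|) ^ 2) * ((∫ x, |u x|) / h + h * C) :=
          mul_le_mul_of_nonneg_left (Finset.sum_le_sum fun i _ => hdir i) (hD0 p hpc)
      _ = _ := by rw [← Finset.sum_mul, mul_assoc]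
  rw [Finset.sum_mul]
  refine le_trans ?_ (Finset.sum_le_sum hloc)
  have hind : ∀ p, Integrable ((Metric.ball p (r p) ∩ Ω).indicator fun x => |g j x|) := fun p =>
    (hu.2 j).abs.indicator (hUo p).measurableSet
  rw [← integral_indicator hΩ.isOpen.measurableSet]
  simp only [← integral_indicator (hUo _).measurableSet]
  rw [← integral_finsetSum _ fun p _ => hind p]
  refine integral_mono ((hu.2 j).abs.indicator hΩ.isOpen.measurableSet)
    (integrable_finsetSum _ fun p _ => hind p) fun x => ?_
  by_cases hx : x ∈ Ω
  · obtain ⟨p, hp, hxp⟩ := mem_iUnion₂.1 (ht (subset_closure hx))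
    rw [indicator_of_mem hx]
    refine le_trans (le_of_eq ?_) (Finset.single_le_sum
      (f := fun p => (Metric.ball p (r p) ∩ Ω).indicator (fun x => |g j x|) x)
      (fun q _ => indicator_nonneg (fun _ _ => abs_nonneg _) _) hp)
    rw [indicator_of_mem (show x ∈ Metric.ball p (r p) ∩ Ω from ⟨hxp, hx⟩)]
  · rw [indicator_of_notMem hx]
    exact Finset.sum_nonneg fun q _ => indicator_nonneg (fun _ _ => abs_nonneg _) _

/-! ### Compactness in `L¹` -/

theorem exists_dist_denseSeq_lt {h : ℝ} (hh : 0 < h) (x : Plane) :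
    ∃ n, dist x (TopologicalSpace.denseSeq Plane n) < h := by
  obtain ⟨_, ⟨n, rfl⟩, hn⟩ :=
    Metric.mem_closure_iff.1 (TopologicalSpace.denseRange_denseSeq Plane x) h hh
  exact ⟨n, hn⟩

open Classical in
/-- The index of the first point of a fixed dense sequence of the plane at distance less than `h`
from `x` (and zero if `h ≤ 0`). -/
def nearIndex (h : ℝ) (x : Plane) : ℕ :=
  if hh : 0 < h then Nat.find (exists_dist_denseSeq_lt hh x) else 0

theorem dist_nearIndex_lt {h : ℝ} (hh : 0 < h) (x : Plane) :
    dist x (TopologicalSpace.denseSeq Plane (nearIndex h x)) < h := by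
  classical
  rw [nearIndex, dif_pos hh]
  exact Nat.find_spec (exists_dist_denseSeq_lt hh x)

theorem measurable_nearIndex (h : ℝ) : Measurable (nearIndex h) := by
  classical
  by_cases hh : 0 < h
  · have : nearIndex h = fun x => Nat.find (exists_dist_denseSeq_lt hh x) := by
      funext x
      rw [nearIndex, dif_pos hh]
    rw [this]
    exact measurable_find _ fun k =>
      (isOpen_lt (continuous_id.dist continuous_const) continuous_const).measurableSet
  · have : nearIndex h = fun _ => 0 := by
      funext x
      rw [nearIndex, dif_neg hh]
    rw [this]
    exact measurable_const

/-- The average of `u` over the ball of radius `h` around the `m`-th point of a dense sequence. -/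
def denseBallAvg (h : ℝ) (u : Plane → ℝ) (m : ℕ) : ℝ :=
  (volume.real (Metric.ball (0 : Plane) h))⁻¹ *
    ∫ y in Metric.ball (TopologicalSpace.denseSeq Plane m) h, u y

/-- A countably valued approximation of `u`: the average over a ball of radius `h` whose centre is
a point of a dense sequence at distance less than `h` from `x`. -/
def ballAvg (h : ℝ) (u : Plane → ℝ) (x : Plane) : ℝ := denseBallAvg h u (nearIndex h x)

theorem measurable_ballAvg (h : ℝ) (u : Plane → ℝ) : Measurable (ballAvg h u) :=
  (measurable_of_countable (denseBallAvg h u)).comp (measurable_nearIndex h)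

theorem volumeReal_ball_pos {h : ℝ} (hh : 0 < h) (c : Plane) :
    0 < volume.real (Metric.ball c h) :=
  ENNReal.toReal_pos (Metric.measure_ball_pos volume c hh).ne' measure_ball_lt_top.ne

theorem volumeReal_ball_center (h : ℝ) (c : Plane) :
    volume.real (Metric.ball c h) = volume.real (Metric.ball (0 : Plane) h) := by
  rw [measureReal_def, Measure.addHaar_ball_center, measureReal_def]

theorem abs_denseBallAvg_le {h : ℝ} (hh : 0 < h) {u : Plane → ℝ} {M : ℝ} (hM : ∀ᵐ x, |u x| ≤ M)
    (m : ℕ) : |denseBallAvg h u m| ≤ M := by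
  have hpos := volumeReal_ball_pos hh 0
  have h1 : ‖∫ y in Metric.ball (TopologicalSpace.denseSeq Plane m) h, u y‖ ≤
      M * volume.real (Metric.ball (TopologicalSpace.denseSeq Plane m) h) :=
    norm_setIntegral_le_of_norm_le_const_ae measure_ball_lt_top (ae_restrict_of_ae hM)
  rw [volumeReal_ball_center, Real.norm_eq_abs] at h1
  rw [denseBallAvg, abs_mul, abs_of_pos (inv_pos.2 hpos), inv_mul_le_iff₀ hpos, mul_comm]
  exact h1

theorem aestronglyMeasurable_translate_sub {u : Plane → ℝ} (hu : AEStronglyMeasurable u)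
    (μ ν : Measure Plane) (hμ : μ ≤ volume) (hν : ν ≤ volume) [SFinite ν] [SFinite μ] :
    AEStronglyMeasurable (fun p : Plane × Plane => u (p.1 + p.2) - u p.1) (μ.prod ν) := by
  have h1 : AEStronglyMeasurable (fun p : Plane × Plane => u (p.1 + p.2))
      ((volume : Measure Plane).prod volume) :=
    hu.comp_quasiMeasurePreserving (quasiMeasurePreserving_add _ _)
  have h2 : AEStronglyMeasurable (fun p : Plane × Plane => u p.1)
      ((volume : Measure Plane).prod volume) :=
    hu.comp_quasiMeasurePreserving Measure.quasiMeasurePreserving_fst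
  exact (h1.sub h2).mono_measure (Measure.prod_mono hμ hν)

/-- The error of the averages over balls of radius `h` is controlled by translations of length less
than `2 h`. The constant `4` is the ratio of the areas of discs of radii `2 h` and `h`. -/
theorem lintegral_sub_ballAvg_le {h : ℝ} (hh : 0 < h) {u : Plane → ℝ} (hu : Integrable u)
    {U : Set Plane} {B : ℝ≥0∞}
    (hB : ∀ z ∈ Metric.ball (0 : Plane) (2 * h), ∫⁻ x in U, ‖u (x + z) - u x‖ₑ ≤ B) :
    ∫⁻ x in U, ‖u x - ballAvg h u x‖ₑ ≤ 4 * B := by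
  have hV0 : volume (Metric.ball (0 : Plane) h) ≠ 0 := (Metric.measure_ball_pos volume _ hh).ne'
  have hVt : volume (Metric.ball (0 : Plane) h) ≠ ⊤ := measure_ball_lt_top.ne
  set V := volume (Metric.ball (0 : Plane) h) with hV
  have h2 : volume (Metric.ball (0 : Plane) (2 * h)) = 4 * V := by
    rw [Measure.addHaar_ball_mul_of_pos _ _ two_pos, finrank_euclideanSpace_fin]
    rw [← hV]
    norm_num
  have hpt : ∀ x, ‖u x - ballAvg h u x‖ₑ ≤
      V⁻¹ * ∫⁻ z in Metric.ball (0 : Plane) (2 * h), ‖u (x + z) - u x‖ₑ := by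
    intro x
    set c := TopologicalSpace.denseSeq Plane (nearIndex h x) with hc
    have hxc : dist x c < h := dist_nearIndex_lt hh x
    have hpos : 0 < V.toReal := ENNReal.toReal_pos hV0 hVt
    have e1 : u x - ballAvg h u x = V.toReal⁻¹ * ∫ y in Metric.ball c h, (u x - u y) := by
      have hcst : Integrable (fun _ : Plane => u x) (volume.restrict (Metric.ball c h)) :=
        integrableOn_const measure_ball_lt_top.ne
      rw [integral_sub hcst hu.integrableOn, setIntegral_const, volumeReal_ball_center, ballAvg,
        denseBallAvg, measureReal_def, ← hV, smul_eq_mul, ← hc]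
      field_simp
    have e2 : ‖V.toReal⁻¹‖ₑ = V⁻¹ := by
      rw [Real.enorm_of_nonneg (inv_nonneg.2 hpos.le), ENNReal.ofReal_inv_of_pos hpos,
        ENNReal.ofReal_toReal hVt]
    rw [e1, enorm_mul, e2]
    refine mul_le_mul_right ?_ _
    refine (enorm_integral_le_lintegral_enorm _).trans ?_
    rw [← lintegral_indicator Metric.isOpen_ball.measurableSet,
      ← lintegral_indicator Metric.isOpen_ball.measurableSet,
      ← lintegral_add_left_eq_self _ x]
    refine lintegral_mono fun z => ?_
    by_cases hz : x + z ∈ Metric.ball c h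
    · have hz2 : z ∈ Metric.ball (0 : Plane) (2 * h) := by
        rw [mem_ball_zero_iff]
        calc ‖z‖ = dist (x + z) x := by simp [dist_eq_norm]
          _ ≤ dist (x + z) c + dist c x := dist_triangle _ _ _
          _ < 2 * h := by
            have : dist (x + z) c < h := hz
            rw [dist_comm c x]
            linarith
      rw [indicator_of_mem hz, indicator_of_mem hz2, ← enorm_neg, neg_sub]
    · rw [indicator_of_notMem hz]
      exact zero_le
  calc ∫⁻ x in U, ‖u x - ballAvg h u x‖ₑ
      ≤ ∫⁻ x in U, V⁻¹ * ∫⁻ z in Metric.ball (0 : Plane) (2 * h), ‖u (x + z) - u x‖ₑ :=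
        lintegral_mono hpt
    _ = V⁻¹ * ∫⁻ x in U, ∫⁻ z in Metric.ball (0 : Plane) (2 * h), ‖u (x + z) - u x‖ₑ :=
        lintegral_const_mul' _ _ (ENNReal.inv_ne_top.2 hV0)
    _ = V⁻¹ * ∫⁻ z in Metric.ball (0 : Plane) (2 * h), ∫⁻ x in U, ‖u (x + z) - u x‖ₑ := by
        rw [lintegral_lintegral_swap]
        exact (aestronglyMeasurable_translate_sub hu.1 _ _ Measure.restrict_le_self
          Measure.restrict_le_self).enorm
    _ ≤ V⁻¹ * ∫⁻ _ in Metric.ball (0 : Plane) (2 * h), B :=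
        mul_le_mul_right (setLIntegral_mono' Metric.isOpen_ball.measurableSet hB) _
    _ = 4 * B := by
        rw [setLIntegral_const, h2, mul_comm 4 V, mul_comm B, ← mul_assoc, ← mul_assoc,
          ENNReal.inv_mul_cancel hV0 hVt, one_mul]

theorem integral_abs_eq_toReal_lintegral {μ : Measure Plane} {f : Plane → ℝ}
    (hf : AEStronglyMeasurable f μ) : ∫ x, |f x| ∂μ = (∫⁻ x, ‖f x‖ₑ ∂μ).toReal := by
  simpa only [Real.norm_eq_abs] using integral_norm_eq_lintegral_enorm hf

theorem exists_subseq_forall_tendsto {ι : Type*} [Countable ι] (a : ℕ → ι → ℝ) (M : ℝ)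
    (ha : ∀ n i, |a n i| ≤ M) :
    ∃ ns : ℕ → ℕ, StrictMono ns ∧
      ∀ i, ∃ l, Filter.Tendsto (fun k => a (ns k) i) Filter.atTop (𝓝 l) := by
  have hK : IsCompact (univ.pi fun _ : ι => Icc (-M) M) := isCompact_univ_pi fun _ => isCompact_Icc
  obtain ⟨l, -, ns, hns, hl⟩ := hK.tendsto_subseq (x := a)
    fun n i _ => ⟨neg_le_of_abs_le (ha n i), le_of_abs_le (ha n i)⟩
  exact ⟨ns, hns, fun i => ⟨l i, tendsto_pi_nhds.1 hl i⟩⟩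

/-- Along a subsequence, the averages of uniformly bounded functions over balls of radius
`1 / (k + 1)` converge in `L¹`, for each `k`: there are only countably many averages. -/
theorem exists_subseq_ballAvg {Ω : Set Plane} (hfinΩ : volume Ω < ⊤) {u : ℕ → Plane → ℝ} {M : ℝ}
    (hM : ∀ n, ∀ᵐ x, |u n x| ≤ M) :
    ∃ ns : ℕ → ℕ, StrictMono ns ∧ ∀ k : ℕ, ∃ b : Plane → ℝ, IntegrableOn b Ω ∧
      Filter.Tendsto (fun i => ∫ x in Ω, |ballAvg (1 / (k + 1)) (u (ns i)) x - b x|)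
        Filter.atTop (𝓝 0) := by
  have hh : ∀ k : ℕ, (0 : ℝ) < 1 / (k + 1) := fun k => by positivity
  have hden : ∀ n (i : ℕ × ℕ), |denseBallAvg (1 / (i.1 + 1)) (u n) i.2| ≤ M := fun n i =>
    abs_denseBallAvg_le (hh i.1) (hM n) i.2
  obtain ⟨ns, hns, hlim⟩ := exists_subseq_forall_tendsto
    (fun n (i : ℕ × ℕ) => denseBallAvg (1 / (i.1 + 1)) (u n) i.2) M hden
  choose a ha using hlim
  refine ⟨ns, hns, fun k => ⟨fun x => a (k, nearIndex (1 / ((k : ℝ) + 1)) x), ?_, ?_⟩⟩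
  all_goals
    have : IsFiniteMeasure (volume.restrict Ω) := ⟨by simpa using hfinΩ⟩
    have ham : Measurable fun x => a (k, nearIndex (1 / ((k : ℝ) + 1)) x) :=
      (measurable_of_countable fun m => a (k, m)).comp (measurable_nearIndex _)
    have haM : ∀ m, |a (k, m)| ≤ M := fun m =>
      le_of_tendsto (ha (k, m)).abs (Filter.Eventually.of_forall fun i => hden (ns i) (k, m))
  · exact Integrable.of_bound ham.aestronglyMeasurable M (ae_of_all _ fun x => haM _)
  · have := tendsto_integral_of_dominated_convergence (μ := volume.restrict Ω)
      (F := fun i x => |ballAvg (1 / ((k : ℝ) + 1)) (u (ns i)) x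
        - a (k, nearIndex (1 / ((k : ℝ) + 1)) x)|)
      (f := fun _ => 0) (fun _ => M + M)
      (fun i => ((measurable_ballAvg _ _).sub ham).abs.aestronglyMeasurable)
      (integrable_const _)
      (fun i => ae_of_all _ fun x => by
        rw [Real.norm_eq_abs, abs_abs]
        exact (abs_sub _ _).trans (add_le_add (hden _ (k, _)) (haM _)))
      (ae_of_all _ fun x => by
        have h1 := (ha (k, nearIndex (1 / ((k : ℝ) + 1)) x)).sub_const
          (a (k, nearIndex (1 / ((k : ℝ) + 1)) x))
        rw [sub_self] at h1
        simpa [ballAvg] using h1.abs)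
    simpa using this

/-- Bounded functions on a bounded open set that are uniformly continuous in the mean have a
subsequence that is Cauchy in `L¹`: the averages over balls around a dense sequence of centres
converge along a subsequence, the averages approximate all the functions equally well in `L¹` away
from the boundary, and a neighbourhood of the boundary has small measure. -/
theorem exists_cauchy_subseq {Ω : Set Plane} (hΩ : IsOpen Ω) (hΩb : Bornology.IsBounded Ω)
    {u : ℕ → Plane → ℝ} (hu : ∀ n, Integrable (u n)) {M C : ℝ} (hM : ∀ n, ∀ᵐ x, |u n x| ≤ M)
    (hz : ∀ n, ∀ x, x ∉ Ω → u n x = 0)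
    (htr : ∀ n U v, IsOpen U → (∀ x ∈ U, ∀ t ∈ Icc (0 : ℝ) 1, x + t • v ∈ Ω) →
      ∫ x in U, |u n (x + v) - u n x| ≤ ‖v‖ * C) :
    ∃ ns : ℕ → ℕ, StrictMono ns ∧ ∀ ε : ℝ, 0 < ε →
      ∃ N, ∀ k l, N ≤ k → N ≤ l → ∫ x, |u (ns k) x - u (ns l) x| ≤ ε := by
  have hM0 : 0 ≤ M := by
    obtain ⟨x, hx⟩ := (hM 0).exists
    exact (abs_nonneg _).trans hx
  have hfinΩ : volume Ω < ⊤ := hΩb.measure_lt_top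
  obtain ⟨ns, hns, hav⟩ := exists_subseq_ballAvg hfinΩ hM
  refine ⟨ns, hns, fun ε hε => ?_⟩
  have hh : ∀ k : ℕ, (0 : ℝ) < 1 / (k + 1) := fun k => by positivity
  have : IsFiniteMeasure (volume.restrict Ω) := ⟨by simpa using hfinΩ⟩
  have hPi : ∀ (k n : ℕ), IntegrableOn (ballAvg (1 / (k + 1)) (u n)) Ω := fun k n =>
    Integrable.of_bound (measurable_ballAvg _ _).aestronglyMeasurable M
      (ae_of_all _ fun x => abs_denseBallAvg_le (hh k) (hM n) _)
  obtain ⟨K, hKΩ, hK, hKv⟩ := hΩ.measurableSet.exists_isCompact_sdiff_lt (μ := volume) hfinΩ.ne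
    (ε := ENNReal.ofReal (ε / (8 * (M + 1)))) (by simp; positivity)
  obtain ⟨δ, hδ, hδΩ⟩ := hK.exists_thickening_subset_open hΩ hKΩ
  set U := Metric.thickening (δ / 2) K with hUdef
  have hUo : IsOpen U := Metric.isOpen_thickening
  have hUΩ : U ⊆ Ω := (Metric.thickening_mono (by linarith) K).trans hδΩ
  have hKU : K ⊆ U := Metric.self_subset_thickening (by positivity) K
  have hseg : ∀ v : Plane, ‖v‖ < δ / 2 → ∀ x ∈ U, ∀ t ∈ Icc (0 : ℝ) 1, x + t • v ∈ Ω := by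
    intro v hv x hx t ht
    refine hδΩ ?_
    rw [hUdef, Metric.mem_thickening_iff] at hx
    rw [Metric.mem_thickening_iff]
    obtain ⟨z, hz, hxz⟩ := hx
    refine ⟨z, hz, ?_⟩
    have h1 : dist (x + t • v) x ≤ ‖v‖ := by
      rw [dist_eq_norm, add_sub_cancel_left, norm_smul, Real.norm_eq_abs, abs_of_nonneg ht.1]
      exact mul_le_of_le_one_left (norm_nonneg _) ht.2
    have := dist_triangle (x + t • v) x z
    linarith
  have hC0 : 0 ≤ C := by
    by_contra hneg
    have h1 := htr 0 ∅ (EuclideanSpace.single 0 1) isOpen_empty (by simp)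
    simp at h1
    exact hneg h1
  obtain ⟨k, hk⟩ := exists_nat_one_div_lt
    (show (0 : ℝ) < min (δ / 4) (ε / (64 * (C + 1))) by positivity)
  have hk1 := lt_of_lt_of_le hk (min_le_left _ _)
  have hk2 := lt_of_lt_of_le hk (min_le_right _ _)
  have happ : ∀ n, ∫ x in U, |u n x - ballAvg (1 / (k + 1)) (u n) x| ≤ ε / 8 := by
    intro n
    rw [integral_abs_eq_toReal_lintegral
      (f := fun x => u n x - ballAvg (1 / (k + 1)) (u n) x) ((hu n).1.restrict.sub
      (measurable_ballAvg _ _).aestronglyMeasurable)]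
    refine ENNReal.toReal_le_of_le_ofReal (by positivity)
      ((lintegral_sub_ballAvg_le (hh k) (hu n) (B := ENNReal.ofReal (ε / 32)) fun z hz => ?_).trans
        (le_of_eq ?_))
    · rw [mem_ball_zero_iff] at hz
      have h1 := htr n U z hUo (hseg z (by linarith))
      have hi : Integrable (fun x => u n (x + z) - u n x) (volume.restrict U) :=
        (((hu n).comp_add_right z).sub (hu n)).integrableOn
      rw [← ofReal_integral_norm_eq_lintegral_enorm hi]
      refine ENNReal.ofReal_le_ofReal (h1.trans ?_)
      have h2 : (1 / ((k : ℝ) + 1)) * (64 * (C + 1)) < ε := by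
        rwa [lt_div_iff₀ (by positivity)] at hk2
      have h3 := hh k
      nlinarith [mul_le_mul_of_nonneg_right hz.le hC0]
    · rw [show (4 : ℝ≥0∞) = ENNReal.ofReal 4 by simp, ← ENNReal.ofReal_mul (by norm_num)]
      congr 1
      ring
  obtain ⟨b, hbi, hdct⟩ := hav k
  obtain ⟨N, hN⟩ := Filter.eventually_atTop.1 (hdct.eventually_lt_const
    (show (0 : ℝ) < ε / 8 by positivity))
  have hrest : volume.real (Ω \ U) ≤ ε / (8 * (M + 1)) := by
    refine ENNReal.toReal_le_of_le_ofReal (by positivity) ((measure_mono ?_).trans hKv.le)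
    exact sdiff_subset_sdiff_right hKU
  refine ⟨N, fun i j hi hj => ?_⟩
  have hint : Integrable (fun x => |u (ns i) x - u (ns j) x|) := ((hu _).sub (hu _)).abs
  have s0 : ∫ x, |u (ns i) x - u (ns j) x| = ∫ x in Ω, |u (ns i) x - u (ns j) x| :=
    (setIntegral_eq_integral_of_forall_compl_eq_zero fun x hx => by
      rw [hz _ x hx, hz _ x hx, sub_zero, abs_zero]).symm
  have s1 : ∫ x in Ω, |u (ns i) x - u (ns j) x| =
      (∫ x in U, |u (ns i) x - u (ns j) x|) + ∫ x in Ω \ U, |u (ns i) x - u (ns j) x| := by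
    rw [← setIntegral_union disjoint_sdiff_right (hΩ.measurableSet.diff hUo.measurableSet)
      hint.integrableOn hint.integrableOn, union_sdiff_cancel hUΩ]
  have s2 : ∫ x in Ω \ U, |u (ns i) x - u (ns j) x| ≤ ε / 4 := by
    have h1 : ‖∫ x in Ω \ U, |u (ns i) x - u (ns j) x|‖ ≤ (M + M) * volume.real (Ω \ U) := by
      refine norm_setIntegral_le_of_norm_le_const_ae
        ((measure_mono sdiff_subset).trans_lt hfinΩ) (ae_restrict_of_ae ?_)
      filter_upwards [hM (ns i), hM (ns j)] with x h1 h2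
      rw [Real.norm_eq_abs, abs_abs]
      exact (abs_sub _ _).trans (add_le_add h1 h2)
    refine (le_abs_self _).trans (h1.trans ?_)
    calc (M + M) * volume.real (Ω \ U) ≤ (M + M) * (ε / (8 * (M + 1))) :=
          mul_le_mul_of_nonneg_left hrest (by linarith)
      _ ≤ ε / 4 := by
          rw [mul_div_assoc', div_le_div_iff₀ (by positivity) (by norm_num)]
          nlinarith
  have hone : ∀ i, N ≤ i → ∫ x in U, |u (ns i) x - b x| ≤ ε / 4 := by
    intro i hi
    have i1 : IntegrableOn (fun x => |u (ns i) x - ballAvg (1 / (k + 1)) (u (ns i)) x|) U :=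
      ((hu _).integrableOn.sub ((hPi k _).mono_set hUΩ)).abs
    have i2 : IntegrableOn (fun x => |ballAvg (1 / (k + 1)) (u (ns i)) x - b x|) Ω :=
      ((hPi k _).sub hbi).abs
    calc ∫ x in U, |u (ns i) x - b x|
        ≤ ∫ x in U, (|u (ns i) x - ballAvg (1 / (k + 1)) (u (ns i)) x|
            + |ballAvg (1 / (k + 1)) (u (ns i)) x - b x|) :=
          integral_mono ((hu _).integrableOn.sub (hbi.mono_set hUΩ)).abs
            (i1.add (i2.mono_set hUΩ)) fun x => abs_sub_le _ _ _
      _ = (∫ x in U, |u (ns i) x - ballAvg (1 / (k + 1)) (u (ns i)) x|)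
            + ∫ x in U, |ballAvg (1 / (k + 1)) (u (ns i)) x - b x| :=
          integral_add i1 (i2.mono_set hUΩ)
      _ ≤ ε / 8 + ε / 8 := by
          refine add_le_add (happ _) (le_trans ?_ (hN i hi).le)
          exact setIntegral_mono_set i2 (ae_of_all _ fun x => abs_nonneg _)
            (Filter.Eventually.of_forall hUΩ)
      _ = ε / 4 := by ring
  have s3 : ∫ x in U, |u (ns i) x - u (ns j) x| ≤ ε / 4 + ε / 4 := by
    have i1 : ∀ i, IntegrableOn (fun x => |u (ns i) x - b x|) U := fun i =>
      ((hu _).integrableOn.sub (hbi.mono_set hUΩ)).abs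
    calc ∫ x in U, |u (ns i) x - u (ns j) x|
        ≤ ∫ x in U, (|u (ns i) x - b x| + |u (ns j) x - b x|) :=
          integral_mono hint.integrableOn ((i1 i).add (i1 j)) fun x => by
            rw [abs_sub_comm (u (ns j) x)]
            exact abs_sub_le _ _ _
      _ = _ := integral_add (i1 i) (i1 j)
      _ ≤ _ := add_le_add (hone i hi) (hone j hj)
  rw [s0, s1]
  linarith

/-! ### Coordinates of vector and matrix fields -/

theorem integral_indicator_mul {Ω : Set Plane} (hΩ : MeasurableSet Ω) (f q : Plane → ℝ) :
    ∫ x, Ω.indicator f x * q x = ∫ x in Ω, f x * q x := by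
  rw [← integral_indicator hΩ]
  refine integral_congr_ae (ae_of_all _ fun x => ?_)
  by_cases hx : x ∈ Ω <;> simp [hx]

theorem integrableOn_coord {Ω : Set Plane} {φ : Plane → Plane} (h : IntegrableOn φ Ω) (i : Fin 2) :
    IntegrableOn (fun x => φ x i) Ω :=
  ContinuousLinearMap.integrable_comp (EuclideanSpace.proj i : Plane →L[ℝ] ℝ) h

theorem IsWeakJacobian.hasWeakGrad {Ω : Set Plane} (hΩ : MeasurableSet Ω) {φ : Plane → Plane}
    {G : Plane → Mat2} (hφ : IntegrableOn φ Ω) (h : IsWeakJacobian Ω φ G) (i : Fin 2) :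
    HasWeakGrad Ω (Ω.indicator fun x => φ x i) (fun j => Ω.indicator fun x => G x i j) := by
  refine ⟨(integrable_indicator_iff hΩ).2 (integrableOn_coord hφ i),
    fun j => (integrable_indicator_iff hΩ).2 (h.1 i j), fun η hη j => ?_⟩
  rw [integral_indicator_mul hΩ, integral_indicator_mul hΩ]
  exact h.2 η hη.1 hη.2 hη.3 i j

theorem pderiv_zero (k : Fin 2) (x : Plane) : pderiv k (fun _ => 0) x = 0 := by
  simp [pderiv]

theorem pderiv_neg (k : Fin 2) (η : Plane → ℝ) (x : Plane) :
    pderiv k (fun y => -η y) x = -pderiv k η x := by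
  simp [pderiv, fderiv_fun_neg]

/-- The tensor field with a single nonzero coordinate. -/
def singleTensor (k i j : Fin 2) (η : Plane → ℝ) : Plane → Fin 2 → Fin 2 → Fin 2 → ℝ :=
  fun x k' i' j' => if k' = k ∧ i' = i ∧ j' = j then η x else 0

theorem isTestTensor_singleTensor {Ω : Set Plane} {η : Plane → ℝ} (hη : IsTest Ω η)
    (h1 : ∀ x, |η x| ≤ 1) (k i j : Fin 2) : IsTestTensor Ω (singleTensor k i j η) := by
  have hz : ∀ x, x ∉ tsupport η → singleTensor k i j η x = 0 := fun x hx => by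
    funext k' i' j'
    simp [singleTensor, image_eq_zero_of_notMem_tsupport hx]
  refine ⟨?_, HasCompactSupport.intro hη.2.isCompact hz, ?_, fun x => ?_⟩
  · refine contDiff_pi.2 fun k' => contDiff_pi.2 fun i' => contDiff_pi.2 fun j' => ?_
    unfold singleTensor
    split_ifs
    · exact hη.1
    · exact contDiff_const
  · refine (closure_minimal (fun x hx => ?_) (isClosed_tsupport η)).trans hη.3
    by_contra h
    exact hx (hz x h)
  · have h2 : (η x) ^ 2 ≤ 1 := by
      rw [← sq_abs]
      exact pow_le_one₀ (abs_nonneg _) (h1 x)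
    refine le_trans (le_of_eq ?_) h2
    fin_cases k <;> fin_cases i <;> fin_cases j <;> simp [singleTensor, Fin.sum_univ_two]

theorem sum_mul_divergence_singleTensor (A : Mat2) (k i j : Fin 2) (η : Plane → ℝ) (x : Plane) :
    ∑ i', ∑ j', A i' j' * divergence (singleTensor k i j η) x i' j' = A i j * pderiv k η x := by
  fin_cases k <;> fin_cases i <;> fin_cases j <;>
    simp [singleTensor, divergence, Fin.sum_univ_two, pderiv_zero]

/-- A bound for the total variation bounds the variation of each entry. -/
theorem varBound_of_totalVariation_le {Ω : Set Plane} (hΩ : MeasurableSet Ω) {u : Plane → Mat2}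
    {C : ℝ} (hC : 0 ≤ C) (h : totalVariation Ω u ≤ ENNReal.ofReal C) (i j : Fin 2) :
    VarBound Ω (Ω.indicator fun x => u x i j) C := by
  have key : ∀ η, IsTest Ω η → (∀ x, |η x| ≤ 1) → ∀ k, ∫ x in Ω, u x i j * pderiv k η x ≤ C := by
    intro η hη h1 k
    have h2 := (le_iSup₂ (f := fun (ψ : Plane → Fin 2 → Fin 2 → Fin 2 → ℝ)
      (_ : IsTestTensor Ω ψ) => ENNReal.ofReal (∫ x in Ω, ∑ i, ∑ j, u x i j * divergence ψ x i j))
      _ (isTestTensor_singleTensor hη h1 k i j)).trans h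
    simp only [sum_mul_divergence_singleTensor] at h2
    exact (ENNReal.ofReal_le_ofReal_iff hC).1 h2
  intro η hη h1 k
  rw [integral_indicator_mul hΩ, abs_le]
  have h2 := key _ hη.neg (fun x => by simpa using h1 x) k
  simp only [pderiv_neg, mul_neg, integral_neg] at h2
  exact ⟨by linarith, key η hη h1 k⟩

theorem integral_pderiv_eq_zero {Ω : Set Plane} {η : Plane → ℝ} (hη : IsTest Ω η) (j : Fin 2) :
    ∫ x, pderiv j η x = 0 := by
  have hc : HasCompactSupport (pderiv j η) :=
    (hη.2.fderiv (𝕜 := ℝ)).comp_left (g := fun L : Plane →L[ℝ] ℝ => L (EuclideanSpace.single j 1))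
      (by simp)
  have := integral_mul_fderiv_eq_neg_fderiv_mul_of_integrable (μ := (volume : Measure Plane))
    (f := fun _ : Plane => (1 : ℝ)) (g := η) (v := EuclideanSpace.single j 1)
    (by simp) (by
      simp only [one_mul]
      exact (hη.continuous_pderiv j).integrable_of_hasCompactSupport hc)
    (by
      simp only [one_mul]
      exact hη.continuous.integrable_of_hasCompactSupport hη.2)
    (fun x _ => differentiableAt_const _) (fun x _ => hη.1.differentiable one_ne_zero x)
  simpa [pderiv] using this

theorem setIntegral_const_mul_pderiv {Ω : Set Plane} {η : Plane → ℝ} (hη : IsTest Ω η) (j : Fin 2)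
    (c : ℝ) : ∫ x in Ω, c * pderiv j η x = 0 := by
  rw [hη.setIntegral_mul_pderiv (fun _ => c), integral_const_mul, integral_pderiv_eq_zero hη,
    mul_zero]

theorem IsTestTensor.isTest {Ω : Set Plane} {ψ : Plane → Fin 2 → Fin 2 → Fin 2 → ℝ}
    (h : IsTestTensor Ω ψ) (k i j : Fin 2) : IsTest Ω fun y => ψ y k i j := by
  have hz : ∀ x, x ∉ tsupport ψ → ψ x k i j = 0 := fun x hx => by
    simp [image_eq_zero_of_notMem_tsupport hx]
  refine ⟨contDiff_pi.1 (contDiff_pi.1 (contDiff_pi.1 h.1 k) i) j,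
    HasCompactSupport.intro h.2.1.isCompact hz, ?_⟩
  refine (closure_minimal (fun x hx => ?_) (isClosed_tsupport ψ)).trans h.2.2.1
  by_contra hc
  exact hx (hz x hc)

theorem IsTestTensor.continuous_divergence {Ω : Set Plane}
    {ψ : Plane → Fin 2 → Fin 2 → Fin 2 → ℝ} (h : IsTestTensor Ω ψ) (i j : Fin 2) :
    Continuous fun x => divergence ψ x i j :=
  continuous_finsetSum Finset.univ fun k _ => (h.isTest k i j).continuous_pderiv k

theorem IsTestTensor.exists_divergence_bound {Ω : Set Plane}
    {ψ : Plane → Fin 2 → Fin 2 → Fin 2 → ℝ} (h : IsTestTensor Ω ψ) (i j : Fin 2) :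
    ∃ c, ∀ x, |divergence ψ x i j| ≤ c := by
  choose c hc using fun k => (h.isTest k i j).exists_pderiv_bound k
  exact ⟨∑ k, c k, fun x => (Finset.abs_sum_le_sum_abs _ Finset.univ).trans
    (Finset.sum_le_sum fun k _ => hc k x)⟩

theorem IsTestTensor.integrable_mul_divergence {Ω : Set Plane}
    {ψ : Plane → Fin 2 → Fin 2 → Fin 2 → ℝ} (h : IsTestTensor Ω ψ) {u : Plane → ℝ}
    (hu : IntegrableOn u Ω) (i j : Fin 2) : IntegrableOn (fun x => u x * divergence ψ x i j) Ω := by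
  obtain ⟨c, hc⟩ := h.exists_divergence_bound i j
  exact hu.mul_bdd (c := c) (h.continuous_divergence i j).aestronglyMeasurable
    (ae_of_all _ fun x => by simpa using hc x)

theorem IsTestTensor.integral_sum_mul_divergence {Ω : Set Plane}
    {ψ : Plane → Fin 2 → Fin 2 → Fin 2 → ℝ} (h : IsTestTensor Ω ψ) {u : Plane → Mat2}
    (hu : ∀ i j, IntegrableOn (fun x => u x i j) Ω) :
    ∫ x in Ω, ∑ i, ∑ j, u x i j * divergence ψ x i j =
      ∑ i, ∑ j, ∫ x in Ω, u x i j * divergence ψ x i j := by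
  have hi := fun i j => h.integrable_mul_divergence (hu i j) i j
  rw [integral_finsetSum _ fun i _ => integrable_finsetSum _ fun j _ => hi i j]
  exact Finset.sum_congr rfl fun i _ => integral_finsetSum _ fun j _ => hi i j

/-- Constant fields are orthogonal to divergences of compactly supported fields. -/
theorem IsTestTensor.integral_const_mul_divergence {Ω : Set Plane} (hΩv : volume Ω ≠ ⊤)
    {ψ : Plane → Fin 2 → Fin 2 → Fin 2 → ℝ} (h : IsTestTensor Ω ψ) (A : Mat2) :
    ∫ x in Ω, ∑ i, ∑ j, A i j * divergence ψ x i j = 0 := by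
  rw [h.integral_sum_mul_divergence (u := fun _ => A) fun i j => integrableOn_const hΩv]
  refine Finset.sum_eq_zero fun i _ => Finset.sum_eq_zero fun j _ => ?_
  have hi : ∀ k, IntegrableOn (fun x => A i j * pderiv k (fun y => ψ y k i j) x) Ω := fun k => by
    obtain ⟨c, hc⟩ := (h.isTest k i j).exists_pderiv_bound k
    have h1 : IntegrableOn (fun _ : Plane => A i j) Ω := integrableOn_const hΩv
    exact h1.mul_bdd (c := c) ((h.isTest k i j).continuous_pderiv k).aestronglyMeasurable
      (ae_of_all _ fun x => by simpa using hc x)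
  simp only [divergence, Matrix.of_apply, Finset.mul_sum]
  rw [integral_finsetSum _ fun k _ => hi k]
  exact Finset.sum_eq_zero fun k _ => setIntegral_const_mul_pderiv (h.isTest k i j) k _

theorem totalVariation_const {Ω : Set Plane} (hΩv : volume Ω ≠ ⊤) (A : Mat2) :
    totalVariation Ω (fun _ => A) = 0 := by
  refine le_antisymm (iSup₂_le fun ψ hψ => ?_) zero_le
  rw [hψ.integral_const_mul_divergence hΩv, ENNReal.ofReal_zero]

theorem totalVariation_sub_const {Ω : Set Plane} (hΩv : volume Ω ≠ ⊤) {u : Plane → Mat2}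
    (hu : ∀ i j, IntegrableOn (fun x => u x i j) Ω) (A : Mat2) :
    totalVariation Ω (fun x => u x - A) = totalVariation Ω u := by
  refine iSup_congr fun ψ => iSup_congr fun hψ => congrArg ENNReal.ofReal ?_
  have h0 := hψ.integral_const_mul_divergence hΩv A
  have i1 : IntegrableOn (fun x => ∑ i, ∑ j, u x i j * divergence ψ x i j) Ω :=
    integrable_finsetSum _ fun i _ => integrable_finsetSum _ fun j _ =>
      hψ.integrable_mul_divergence (hu i j) i j
  have i2 : IntegrableOn (fun x => ∑ i, ∑ j, A i j * divergence ψ x i j) Ω :=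
    integrable_finsetSum _ fun i _ => integrable_finsetSum _ fun j _ =>
      hψ.integrable_mul_divergence (integrableOn_const hΩv) i j
  refine Eq.trans ?_ ((integral_sub i1 i2).trans (by rw [h0, sub_zero]))
  simp only [Matrix.sub_apply, sub_mul, Finset.sum_sub_distrib]

/-! ### Limits in `L¹` -/

theorem exists_L1_limit {μ : Measure Plane} {f : ℕ → Plane → ℝ} (hf : ∀ n, Integrable (f n) μ)
    (hc : ∀ ε : ℝ, 0 < ε → ∃ N, ∀ k l, N ≤ k → N ≤ l → ∫ x, |f k x - f l x| ∂μ ≤ ε) :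
    ∃ F : Plane → ℝ, Integrable F μ ∧
      Filter.Tendsto (fun k => ∫ x, |f k x - F x| ∂μ) Filter.atTop (𝓝 0) := by
  have hd : ∀ (g g' : Plane → ℝ) (hg : Integrable g μ) (hg' : Integrable g' μ),
      dist (hg.toL1 g) (hg'.toL1 g') = ∫ x, |g x - g' x| ∂μ := fun g g' hg hg' => by
    rw [dist_eq_norm, ← Integrable.toL1_sub, L1.norm_of_fun_eq_integral_norm]
    rfl
  have hcs : CauchySeq fun n => (hf n).toL1 (f n) := by
    refine Metric.cauchySeq_iff.2 fun ε hε => ?_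
    obtain ⟨N, hN⟩ := hc (ε / 2) (by positivity)
    refine ⟨N, fun k hk l hl => ?_⟩
    rw [hd]
    linarith [hN k l hk hl]
  obtain ⟨F, hF⟩ := cauchySeq_tendsto_of_complete hcs
  refine ⟨F, L1.integrable_coeFn F, ?_⟩
  rw [tendsto_iff_dist_tendsto_zero] at hF
  refine hF.congr fun k => ?_
  conv_lhs => rw [← Integrable.toL1_coeFn F (L1.integrable_coeFn F)]
  exact hd _ _ _ _

theorem exists_subseq_ae_tendsto {ι : Type*} [Fintype ι] {μ : Measure Plane}
    {f : ℕ → ι → Plane → ℝ} {F : ι → Plane → ℝ} (hf : ∀ n i, Integrable (f n i) μ)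
    (hF : ∀ i, Integrable (F i) μ)
    (h : ∀ i, Filter.Tendsto (fun k => ∫ x, |f k i x - F i x| ∂μ) Filter.atTop (𝓝 0)) :
    ∃ ns : ℕ → ℕ, StrictMono ns ∧ ∀ᵐ x ∂μ, ∀ i,
      Filter.Tendsto (fun k => f (ns k) i x) Filter.atTop (𝓝 (F i x)) := by
  have hi : ∀ n i, Integrable (fun x => |f n i x - F i x|) μ := fun n i =>
    ((hf n i).sub (hF i)).abs
  have hs : ∀ n, Integrable (fun x => ∑ i, |f n i x - F i x|) μ := fun n =>
    integrable_finsetSum _ fun i _ => hi n i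
  have h0 : Filter.Tendsto (fun n => ∫ x, ∑ i, |f n i x - F i x| ∂μ) Filter.atTop (𝓝 0) := by
    have := tendsto_finsetSum (Finset.univ : Finset ι) fun i _ => h i
    simp only [Finset.sum_const_zero] at this
    refine this.congr fun n => ?_
    rw [integral_finsetSum _ fun i _ => hi n i]
  have hm : TendstoInMeasure μ (fun n x => ∑ i, |f n i x - F i x|) Filter.atTop fun _ => 0 := by
    refine tendstoInMeasure_of_tendsto_eLpNorm one_ne_zero (fun n => (hs n).1)
      aestronglyMeasurable_const ?_
    have := (ENNReal.continuous_ofReal.tendsto 0).comp h0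
    rw [ENNReal.ofReal_zero] at this
    refine this.congr fun n => ?_
    rw [eLpNorm_one_eq_lintegral_enorm, Function.comp_apply]
    have e := ofReal_integral_norm_eq_lintegral_enorm (hs n)
    have e2 : ∀ x, ‖∑ i, |f n i x - F i x|‖ = ∑ i, |f n i x - F i x| := fun x =>
      Real.norm_of_nonneg (Finset.sum_nonneg fun i _ => abs_nonneg _)
    simp only [e2] at e
    rw [e]
    simp
  obtain ⟨ns, hns, hae⟩ := hm.exists_seq_tendsto_ae
  refine ⟨ns, hns, hae.mono fun x hx i => ?_⟩
  rw [tendsto_iff_dist_tendsto_zero]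
  refine squeeze_zero (fun k => dist_nonneg) (fun k => ?_) hx
  rw [Real.dist_eq]
  exact Finset.single_le_sum (f := fun i => |f (ns k) i x - F i x|) (fun i _ => abs_nonneg _)
    (Finset.mem_univ i)

theorem tendsto_integral_mul {μ : Measure Plane} {f : ℕ → Plane → ℝ} {F q : Plane → ℝ} {c : ℝ}
    (hf : ∀ n, Integrable (f n) μ) (hF : Integrable F μ) (hq : Continuous q)
    (hc : ∀ x, |q x| ≤ c)
    (h : Filter.Tendsto (fun k => ∫ x, |f k x - F x| ∂μ) Filter.atTop (𝓝 0)) :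
    Filter.Tendsto (fun k => ∫ x, f k x * q x ∂μ) Filter.atTop (𝓝 (∫ x, F x * q x ∂μ)) := by
  have hm : ∀ {g : Plane → ℝ}, Integrable g μ → Integrable (fun x => g x * q x) μ := fun hg =>
    hg.mul_bdd (c := c) hq.aestronglyMeasurable (ae_of_all _ fun x => by simpa using hc x)
  rw [tendsto_iff_dist_tendsto_zero]
  refine squeeze_zero (fun k => dist_nonneg) (fun k => ?_) (by simpa using h.const_mul c)
  rw [Real.dist_eq, ← integral_sub (hm (hf k)) (hm hF)]
  simp only [← sub_mul]
  exact abs_integral_mul_le ((hf k).sub hF) hc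

/-! ### Compactness of bounded maps with gradients of bounded variation -/

/-- Rellich compactness for bounded functions with gradients of bounded variation: the interpolation
inequality bounds the gradients in `L¹`, hence the translations. -/
theorem IsBoundedLipschitzDomain.exists_cauchy_subseq {Ω : Set Plane}
    (hΩ : IsBoundedLipschitzDomain Ω) {u : ℕ → Plane → ℝ} {g : ℕ → Fin 2 → Plane → ℝ} {M C : ℝ}
    (hu : ∀ n, HasWeakGrad Ω (u n) (g n)) (hM : ∀ n, ∀ᵐ x, |u n x| ≤ M)
    (hz : ∀ n x, x ∉ Ω → u n x = 0) (hC : ∀ n j, VarBound Ω (g n j) C) :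
    ∃ ns : ℕ → ℕ, StrictMono ns ∧ ∀ ε : ℝ, 0 < ε →
      ∃ N, ∀ k l, N ≤ k → N ≤ l → ∫ x, |u (ns k) x - u (ns l) x| ≤ ε := by
  obtain ⟨D, hD0, hD⟩ := hΩ.exists_interpolation
  have hfin : volume Ω < ⊤ := hΩ.isBounded.measure_lt_top
  have hL1 : ∀ n, ∫ x, |u n x| ≤ M * volume.real Ω := by
    intro n
    have e : ∫ x, |u n x| = ∫ x in Ω, |u n x| :=
      (setIntegral_eq_integral_of_forall_compl_eq_zero fun x hx => by rw [hz n x hx, abs_zero]).symm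
    rw [e]
    have h1 : ‖∫ x in Ω, |u n x|‖ ≤ M * volume.real Ω :=
      norm_setIntegral_le_of_norm_le_const_ae hfin
        (ae_restrict_of_ae ((hM n).mono fun x hx => by rwa [Real.norm_eq_abs, abs_abs]))
    exact (le_abs_self _).trans h1
  have hg : ∀ n j, ∫ x in Ω, |g n j x| ≤ D * (M * volume.real Ω + C) := fun n j => by
    refine (hD _ _ C (hu n) (hC n) 1 one_pos le_rfl j).trans
      (mul_le_mul_of_nonneg_left ?_ hD0)
    rw [div_one, one_mul]
    linarith [hL1 n]
  refine EBSDFlow.exists_cauchy_subseq (M := M) (C := 2 * (D * (M * volume.real Ω + C))) hΩ.isOpen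
    hΩ.isBounded (fun n => (hu n).1) hM hz fun n U v hU hUv => ?_
  refine ((hu n).integral_abs_translate_le hU hUv).trans ?_
  have hv : ∀ j, |v j| ≤ ‖v‖ := fun j => by
    simpa using PiLp.norm_apply_le v j
  rw [Fin.sum_univ_two]
  have hi : ∀ j, 0 ≤ ∫ x in Ω, |g n j x| := fun j => integral_nonneg fun x => abs_nonneg _
  have h0 := mul_le_mul (hv 0) (hg n 0) (hi 0) (norm_nonneg v)
  have h1 := mul_le_mul (hv 1) (hg n 1) (hi 1) (norm_nonneg v)
  linarith

/-- For functions whose gradients have uniformly bounded variation, an `L¹` Cauchy sequence has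
gradients that are Cauchy in `L¹`. -/
theorem IsBoundedLipschitzDomain.cauchy_grad {Ω : Set Plane}
    (hΩ : IsBoundedLipschitzDomain Ω) {u : ℕ → Plane → ℝ} {g : ℕ → Fin 2 → Plane → ℝ} {C : ℝ}
    (hu : ∀ n, HasWeakGrad Ω (u n) (g n)) (hC : ∀ n j, VarBound Ω (g n j) C)
    (hc : ∀ ε : ℝ, 0 < ε → ∃ N, ∀ k l, N ≤ k → N ≤ l → ∫ x, |u k x - u l x| ≤ ε) (j : Fin 2)
    {ε : ℝ} (hε : 0 < ε) :
    ∃ N, ∀ k l, N ≤ k → N ≤ l → ∫ x in Ω, |g k j x - g l j x| ≤ ε := by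
  obtain ⟨D, hD0, hD⟩ := hΩ.exists_interpolation
  have hC0 : 0 ≤ C := (hC 0 0).nonneg
  -- with this `h`, the variation term of the interpolation inequality is at most `ε / 2`
  set h : ℝ := min 1 (ε / (4 * (D + 1) * (C + 1))) with hh
  have h0 : 0 < h := by positivity
  have h2 : h * (4 * (D + 1) * (C + 1)) ≤ ε := by
    rw [← le_div_iff₀ (by positivity)]
    exact min_le_right _ _
  obtain ⟨N, hN⟩ := hc (h * (ε / (2 * (D + 1)))) (by positivity)
  refine ⟨N, fun k l hk hl => ?_⟩
  have h3 := hD _ _ (C + C) ((hu k).sub (hu l))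
    (fun j => (hC k j).sub (hC l j) ((hu k).2 j) ((hu l).2 j)) h h0 (min_le_left _ _) j
  have h4 : (∫ x, |u k x - u l x|) / h ≤ ε / (2 * (D + 1)) := by
    rw [div_le_iff₀ h0, mul_comm]
    exact hN k l hk hl
  refine h3.trans ?_
  have h5 : D * (ε / (2 * (D + 1))) ≤ ε / 2 := by
    rw [mul_div_assoc', div_le_div_iff₀ (by positivity) (by norm_num)]
    nlinarith
  have h6 : D * (h * (C + C)) ≤ ε / 2 := by
    have : D * C ≤ (D + 1) * (C + 1) := by nlinarith
    nlinarith
  calc D * ((∫ x, |u k x - u l x|) / h + h * (C + C))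
      ≤ D * (ε / (2 * (D + 1)) + h * (C + C)) :=
        mul_le_mul_of_nonneg_left (by linarith) hD0
    _ ≤ ε := by rw [mul_add]; linarith

/-- Sequential compactness in `W^{1,1}` of bounded maps with gradients of bounded variation, with
pointwise convergence almost everywhere. -/
theorem IsBoundedLipschitzDomain.exists_convergent_subseq {Ω : Set Plane}
    (hΩ : IsBoundedLipschitzDomain Ω) {φ : ℕ → Plane → Plane} {G : ℕ → Plane → Mat2} {M C : ℝ}
    (hφ : ∀ n, IntegrableOn (φ n) Ω) (hG : ∀ n, IsWeakJacobian Ω (φ n) (G n))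
    (hM : ∀ n i, ∀ᵐ x ∂(volume.restrict Ω), |φ n x i| ≤ M)
    (hC : ∀ n i j, VarBound Ω (Ω.indicator fun x => G n x i j) C) :
    ∃ ns : ℕ → ℕ, StrictMono ns ∧ ∃ (φ₀ : Plane → Plane) (G₀ : Plane → Mat2),
      IntegrableOn φ₀ Ω ∧ IsWeakJacobian Ω φ₀ G₀ ∧
      (∀ i j, Filter.Tendsto (fun k => ∫ x in Ω, |G (ns k) x i j - G₀ x i j|)
        Filter.atTop (𝓝 0)) ∧
      ∀ᵐ x ∂(volume.restrict Ω),
        Filter.Tendsto (fun k => φ (ns k) x) Filter.atTop (𝓝 (φ₀ x)) ∧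
        ∀ i j, Filter.Tendsto (fun k => G (ns k) x i j) Filter.atTop (𝓝 (G₀ x i j)) := by
  have hΩm := hΩ.isOpen.measurableSet
  have hu : ∀ n i, HasWeakGrad Ω (Ω.indicator fun x => φ n x i)
      (fun j => Ω.indicator fun x => G n x i j) := fun n i => (hG n).hasWeakGrad hΩm (hφ n) i
  have hMn : 0 ≤ max M 0 := le_max_right _ _
  have hM' : ∀ n i, ∀ᵐ x, |Ω.indicator (fun x => φ n x i) x| ≤ max M 0 := by
    intro n i
    filter_upwards [(ae_restrict_iff' hΩm).1 (hM n i)] with x hx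
    by_cases hxΩ : x ∈ Ω
    · rw [indicator_of_mem hxΩ]
      exact (hx hxΩ).trans (le_max_left _ _)
    · rw [indicator_of_notMem hxΩ, abs_zero]
      exact hMn
  obtain ⟨n₁, hn₁, hc₁⟩ := hΩ.exists_cauchy_subseq (fun n => hu n 0) (fun n => hM' n 0)
    (fun n x hx => indicator_of_notMem hx _) fun n j => hC n 0 j
  obtain ⟨n₂, hn₂, hc₂⟩ := hΩ.exists_cauchy_subseq (fun n => hu (n₁ n) 1) (fun n => hM' (n₁ n) 1)
    (fun n x hx => indicator_of_notMem hx _) fun n j => hC (n₁ n) 1 j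
  have hcφ : ∀ i, ∀ ε : ℝ, 0 < ε → ∃ N, ∀ k l, N ≤ k → N ≤ l →
      ∫ x, |Ω.indicator (fun x => φ (n₁ (n₂ k)) x i) x
        - Ω.indicator (fun x => φ (n₁ (n₂ l)) x i) x| ≤ ε := by
    intro i ε hε
    fin_cases i
    · obtain ⟨N, hN⟩ := hc₁ ε hε
      exact ⟨N, fun k l hk hl => hN _ _ (hk.trans hn₂.le_apply) (hl.trans hn₂.le_apply)⟩
    · exact hc₂ ε hε
  have hcG : ∀ i j, ∀ ε : ℝ, 0 < ε → ∃ N, ∀ k l, N ≤ k → N ≤ l →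
      ∫ x in Ω, |G (n₁ (n₂ k)) x i j - G (n₁ (n₂ l)) x i j| ≤ ε := by
    intro i j ε hε
    obtain ⟨N, hN⟩ := hΩ.cauchy_grad (fun n => hu (n₁ (n₂ n)) i) (fun n j => hC (n₁ (n₂ n)) i j)
      (hcφ i) j hε
    refine ⟨N, fun k l hk hl => (hN k l hk hl).trans' (le_of_eq ?_)⟩
    refine setIntegral_congr_fun hΩm fun x hx => ?_
    simp only [indicator_of_mem hx]
  have hcφ' : ∀ i, ∀ ε : ℝ, 0 < ε → ∃ N, ∀ k l, N ≤ k → N ≤ l →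
      ∫ x in Ω, |φ (n₁ (n₂ k)) x i - φ (n₁ (n₂ l)) x i| ≤ ε := by
    intro i ε hε
    obtain ⟨N, hN⟩ := hcφ i ε hε
    refine ⟨N, fun k l hk hl => (hN k l hk hl).trans' (le_of_eq ?_)⟩
    rw [← integral_indicator hΩm]
    refine integral_congr_ae (ae_of_all _ fun x => ?_)
    by_cases hx : x ∈ Ω <;> simp [hx]
  choose F hFi hF using fun i => exists_L1_limit
    (fun n => integrableOn_coord (hφ (n₁ (n₂ n))) i) (hcφ' i)
  choose H hHi hH using fun i j => exists_L1_limit (fun n => (hG (n₁ (n₂ n))).1 i j) (hcG i j)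
  obtain ⟨n₃, hn₃, hae⟩ := exists_subseq_ae_tendsto (ι := Fin 2 ⊕ Fin 2 × Fin 2)
    (μ := volume.restrict Ω)
    (f := fun n => Sum.elim (fun i x => φ (n₁ (n₂ n)) x i) fun p x => G (n₁ (n₂ n)) x p.1 p.2)
    (F := Sum.elim F fun p => H p.1 p.2)
    (by
      rintro n (i | p)
      · exact integrableOn_coord (hφ _) i
      · exact (hG _).1 p.1 p.2)
    (by
      rintro (i | p)
      · exact hFi i
      · exact hHi p.1 p.2)
    (by
      rintro (i | p)
      · exact hF i
      · exact hH p.1 p.2)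
  have ht := hn₃.tendsto_atTop
  refine ⟨fun k => n₁ (n₂ (n₃ k)), hn₁.comp (hn₂.comp hn₃), fun x => WithLp.toLp 2 fun i => F i x,
    fun x => Matrix.of fun i j => H i j x, ?_, ⟨fun i j => hHi i j, fun η h1 h2 h3 i j => ?_⟩,
    fun i j => (hH i j).comp ht, hae.mono fun x hx => ⟨?_, fun i j => hx (Sum.inr (i, j))⟩⟩
  · have : Integrable (fun x i => F i x) (volume.restrict Ω) := Integrable.of_eval hFi
    exact ContinuousLinearMap.integrable_comp
      ((PiLp.continuousLinearEquiv 2 ℝ fun _ : Fin 2 => ℝ).symm :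
        (Fin 2 → ℝ) →L[ℝ] Plane) this
  · have hη : IsTest Ω η := ⟨h1, h2, h3⟩
    obtain ⟨c, hc⟩ := hη.exists_bound
    obtain ⟨c', hc'⟩ := hη.exists_pderiv_bound j
    have l1 := tendsto_integral_mul (fun n => integrableOn_coord (hφ (n₁ (n₂ n))) i) (hFi i)
      (hη.continuous_pderiv j) hc' (hF i)
    have l2 := (tendsto_integral_mul (fun n => (hG (n₁ (n₂ n))).1 i j) (hHi i j)
      hη.continuous hc (hH i j)).neg
    refine tendsto_nhds_unique l1 (l2.congr fun n => ?_)
    exact ((hG (n₁ (n₂ n))).2 η h1 h2 h3 i j).symm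
  · have h1 : Filter.Tendsto (fun k i => φ (n₁ (n₂ (n₃ k))) x i) Filter.atTop
        (𝓝 fun i => F i x) := tendsto_pi_nhds.2 fun i => hx (Sum.inl i)
    exact ((PiLp.continuous_toLp 2 fun _ : Fin 2 => ℝ).tendsto _).comp h1

/-! ### Continuity of the data term -/

/-- The rotation part of `!![a, b; c, d]` has first column proportional to `(a + d, c - b)`. -/
theorem polarRotation_entries {A : Mat2} (hA : 0 < A.det) :
    0 < (A 0 0 + A 1 1) ^ 2 + (A 1 0 - A 0 1) ^ 2 ∧
    (polarRotation A : Mat2) 0 0 =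
      (A 0 0 + A 1 1) / √((A 0 0 + A 1 1) ^ 2 + (A 1 0 - A 0 1) ^ 2) ∧
    (polarRotation A : Mat2) 1 0 =
      (A 1 0 - A 0 1) / √((A 0 0 + A 1 1) ^ 2 + (A 1 0 - A 0 1) ^ 2) := by
  have hpos : 0 < (A 0 0 + A 1 1) ^ 2 + (A 1 0 - A 0 1) ^ 2 := by
    rw [Matrix.det_fin_two] at hA
    nlinarith [sq_nonneg (A 0 0 - A 1 1), sq_nonneg (A 0 1 + A 1 0)]
  refine ⟨hpos, ?_⟩
  have hR : polarRotation A = (existsUnique_polar A hA).choose := dif_pos hA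
  obtain ⟨V, hV, hAV⟩ := (existsUnique_polar A hA).choose_spec.1
  rw [← hR] at hAV
  obtain ⟨h1, h2, h3⟩ := Matrix.mem_specialOrthogonalGroup_fin_two_iff.1 (polarRotation A).2
  clear hR
  generalize (polarRotation A : Mat2) = R at *
  have hs : V 1 0 = V 0 1 := by simpa using hV.isHermitian.apply 0 1
  have ht : 0 ≤ V 0 0 + V 1 1 := add_nonneg hV.diag_nonneg hV.diag_nonneg
  have e : ∀ i j, A i j = R i 0 * V 0 j + R i 1 * V 1 j := fun i j => by
    rw [hAV, Matrix.mul_apply, Fin.sum_univ_two]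
  have hp : A 0 0 + A 1 1 = R 0 0 * (V 0 0 + V 1 1) := by
    rw [e 0 0, e 1 1, h1, h2, hs]; ring
  have hq : A 1 0 - A 0 1 = R 1 0 * (V 0 0 + V 1 1) := by
    rw [e 1 0, e 0 1, h1, h2, hs]; ring
  have hn : √((A 0 0 + A 1 1) ^ 2 + (A 1 0 - A 0 1) ^ 2) = V 0 0 + V 1 1 := by
    rw [Real.sqrt_eq_iff_mul_self_eq hpos.le ht, hp, hq]
    rw [h2] at h3
    linear_combination (V 0 0 + V 1 1) ^ 2 * h3
  have hne : V 0 0 + V 1 1 ≠ 0 := by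
    rw [← hn]
    exact (Real.sqrt_pos.2 hpos).ne'
  rw [hn]
  exact ⟨by rw [hp, mul_div_cancel_right₀ _ hne], by rw [hq, mul_div_cancel_right₀ _ hne]⟩

theorem continuousOn_polarRotation : ContinuousOn polarRotation {A : Mat2 | 0 < A.det} := by
  have hentry : ∀ i j : Fin 2, Continuous fun A : Mat2 => A i j := fun i j => by fun_prop
  have hs : ∀ A ∈ {A : Mat2 | 0 < A.det},
      √((A 0 0 + A 1 1) ^ 2 + (A 1 0 - A 0 1) ^ 2) ≠ 0 := fun A hA =>
    (Real.sqrt_pos.2 (polarRotation_entries hA).1).ne'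
  have c0 : ContinuousOn (fun A => (polarRotation A : Mat2) 0 0) {A : Mat2 | 0 < A.det} := by
    refine ContinuousOn.congr (ContinuousOn.div (Continuous.continuousOn ?_)
      (Continuous.continuousOn ?_) hs) fun A hA => (polarRotation_entries hA).2.1
    · fun_prop
    · fun_prop
  have c1 : ContinuousOn (fun A => (polarRotation A : Mat2) 1 0) {A : Mat2 | 0 < A.det} := by
    refine ContinuousOn.congr (ContinuousOn.div (Continuous.continuousOn ?_)
      (Continuous.continuousOn ?_) hs) fun A hA => (polarRotation_entries hA).2.2
    · fun_prop
    · fun_prop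
  rw [Topology.IsInducing.subtypeVal.continuousOn_iff]
  have hR := fun A : Mat2 => Matrix.mem_specialOrthogonalGroup_fin_two_iff.1 (polarRotation A).2
  refine continuousOn_pi.2 fun i => continuousOn_pi.2 fun j => ?_
  fin_cases i <;> fin_cases j
  · exact c0
  · refine c1.neg.congr fun A _ => ?_
    exact (hR A).2.1
  · exact c1
  · exact c0.congr fun A _ => (hR A).1.symm

theorem continuous_aboutThirdAxis : Continuous aboutThirdAxis := by
  have h : ∀ i j : Fin 2, Continuous fun R : SO2 => (R : Mat2) i j := fun i j =>
    (continuous_apply_apply i j).comp continuous_subtype_val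
  refine continuous_induced_rng.2 (continuous_pi fun i => continuous_pi fun j => ?_)
  fin_cases i <;> fin_cases j <;>
    first
    | exact continuous_const
    | exact h _ _

theorem continuous_minDist (S : Subgroup SO3) [Finite S] :
    Continuous fun p : SO3 × SO3 => minDist S p.1 p.2 := by
  have := Fintype.ofFinite S
  have e : (fun p : SO3 × SO3 => minDist S p.1 p.2) =
      fun p => Finset.univ.inf' Finset.univ_nonempty fun s : S => distSO3 (p.1 * s) p.2 := by
    funext p
    rw [Finset.inf'_univ_eq_ciInf, minDist]
  rw [e]
  refine Continuous.finset_inf'_apply _ fun s _ => ?_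
  unfold distSO3
  refine continuous_const.mul (Real.continuous_arccos.comp ?_)
  have h1 : Continuous fun p : SO3 × SO3 => ((p.1 * s : SO3) : Matrix (Fin 3) (Fin 3) ℝ) :=
    continuous_subtype_val.comp (continuous_fst.mul continuous_const)
  have h2 : Continuous fun p : SO3 × SO3 => (p.2 : Matrix (Fin 3) (Fin 3) ℝ) :=
    continuous_subtype_val.comp continuous_snd
  exact ((h1.matrix_transpose.matrix_mul h2).matrix_trace.sub continuous_const).div_const _

theorem continuous_distMod (S : Subgroup SO3) [Finite S] :
    Continuous fun p : (SO3 ⧸ S) × (SO3 ⧸ S) => distMod S p.1 p.2 := by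
  rw [← (QuotientGroup.isOpenQuotientMap_mk.prodMap
    QuotientGroup.isOpenQuotientMap_mk).continuous_comp_iff]
  exact continuous_minDist S

theorem distMod_le (S : Subgroup SO3) [Finite S] (p q : SO3 ⧸ S) :
    distMod S p q ≤ √2 * Real.pi := by
  induction p using QuotientGroup.induction_on with | H P => ?_
  induction q using QuotientGroup.induction_on with | H Q => ?_
  obtain ⟨s, hs⟩ := exists_minDist_eq S P Q
  calc distMod S P Q = minDist S P Q := rfl
    _ = distSO3 (P * s) Q := hs
    _ ≤ √2 * Real.pi := mul_le_mul_of_nonneg_left (Real.arccos_le_pi _) (Real.sqrt_nonneg _)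

/-- The integrand of the data term as a function of the gradient, the point and its image; the
gradient is given by its entries. -/
def dataIntegrand (S : Subgroup SO3) (I₁ I₂ : Plane → SO3 ⧸ S)
    (p : (Fin 2 → Fin 2 → ℝ) × Plane × Plane) : ℝ :=
  distMod S (aboutThirdAxis (polarRotation (Matrix.of p.1)) • I₁ p.2.1) (I₂ p.2.2)

/-- The set of gradients of positive determinant, points of `closure Ω`, and values in
`closure Ω₁`. -/
def dataSet (Ω Ω₁ : Set Plane) : Set ((Fin 2 → Fin 2 → ℝ) × Plane × Plane) :=
  {A | 0 < (Matrix.of A).det} ×ˢ closure Ω ×ˢ closure Ω₁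

theorem measurableSet_dataSet (Ω Ω₁ : Set Plane) : MeasurableSet (dataSet Ω Ω₁) := by
  have hc : Continuous fun A : Fin 2 → Fin 2 → ℝ => (Matrix.of A).det :=
    Continuous.matrix_det continuous_id
  exact (isOpen_lt continuous_const hc).measurableSet.prod
    (isClosed_closure.measurableSet.prod isClosed_closure.measurableSet)

theorem continuousOn_dataIntegrand {Ω Ω₁ : Set Plane} (S : Subgroup SO3) [Finite S]
    {I₁ I₂ : Plane → SO3 ⧸ S} (hI₁ : ContinuousOn I₁ (closure Ω))
    (hI₂ : ContinuousOn I₂ (closure Ω₁)) :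
    ContinuousOn (dataIntegrand S I₁ I₂) (dataSet Ω Ω₁) := by
  have h1 : ContinuousOn (fun p : (Fin 2 → Fin 2 → ℝ) × Plane × Plane =>
      aboutThirdAxis (polarRotation (Matrix.of p.1))) (dataSet Ω Ω₁) :=
    continuous_aboutThirdAxis.comp_continuousOn
      (continuousOn_polarRotation.comp (Continuous.continuousOn continuous_fst) fun p hp => hp.1)
  have h2 : ContinuousOn (fun p : (Fin 2 → Fin 2 → ℝ) × Plane × Plane => I₁ p.2.1)
      (dataSet Ω Ω₁) := hI₁.comp (by fun_prop) fun p hp => hp.2.1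
  have h3 : ContinuousOn (fun p : (Fin 2 → Fin 2 → ℝ) × Plane × Plane => I₂ p.2.2)
      (dataSet Ω Ω₁) := hI₂.comp (by fun_prop) fun p hp => hp.2.2
  exact (continuous_distMod S).comp_continuousOn ((h1.smul h2).prodMk h3)

/-! ### Lower semicontinuity of the energy -/

theorem add_liminf_le_liminf_add (u v : ℕ → ℝ≥0∞) :
    Filter.liminf u Filter.atTop + Filter.liminf v Filter.atTop ≤
      Filter.liminf (fun n => u n + v n) Filter.atTop := by
  simp only [Filter.liminf_eq_iSup_iInf_of_nat]
  rw [ENNReal.iSup_add_iSup_of_monotone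
    (fun m n h => biInf_mono fun i hi => le_trans h hi)
    (fun m n h => biInf_mono fun i hi => le_trans h hi)]
  exact iSup_mono fun n => le_iInf₂ fun i hi =>
    add_le_add (iInf₂_le i hi) (iInf₂_le i hi)

theorem totalVariation_le_liminf {Ω : Set Plane} {u : ℕ → Plane → Mat2} {u₀ : Plane → Mat2}
    (hu : ∀ n i j, IntegrableOn (fun x => u n x i j) Ω)
    (hu₀ : ∀ i j, IntegrableOn (fun x => u₀ x i j) Ω)
    (h : ∀ i j, Filter.Tendsto (fun n => ∫ x in Ω, |u n x i j - u₀ x i j|) Filter.atTop (𝓝 0)) :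
    totalVariation Ω u₀ ≤ Filter.liminf (fun n => totalVariation Ω (u n)) Filter.atTop := by
  refine iSup₂_le fun ψ hψ => ?_
  have ht : Filter.Tendsto (fun n => ∫ x in Ω, ∑ i, ∑ j, u n x i j * divergence ψ x i j)
      Filter.atTop (𝓝 (∫ x in Ω, ∑ i, ∑ j, u₀ x i j * divergence ψ x i j)) := by
    rw [hψ.integral_sum_mul_divergence hu₀]
    simp only [hψ.integral_sum_mul_divergence (hu _)]
    refine tendsto_finsetSum _ fun i _ => tendsto_finsetSum _ fun j _ => ?_
    obtain ⟨c, hc⟩ := hψ.exists_divergence_bound i j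
    exact tendsto_integral_mul (fun n => hu n i j) (hu₀ i j) (hψ.continuous_divergence i j) hc
      (h i j)
  rw [← ((ENNReal.continuous_ofReal.tendsto _).comp ht).liminf_eq]
  exact Filter.liminf_le_liminf (Filter.Eventually.of_forall fun n =>
    le_iSup₂ (f := fun (ψ : Plane → Fin 2 → Fin 2 → Fin 2 → ℝ) (_ : IsTestTensor Ω ψ) =>
      ENNReal.ofReal (∫ x in Ω, ∑ i, ∑ j, u n x i j * divergence ψ x i j)) ψ hψ)

theorem lowerSemicontinuous_detPenalty : LowerSemicontinuous detPenalty := by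
  intro t c hc
  by_cases ht : 0 < t
  · have h1 : ContinuousAt (fun s : ℝ => ENNReal.ofReal (s⁻¹ + s)) t :=
      ENNReal.continuous_ofReal.continuousAt.comp
        ((continuousAt_inv₀ ht.ne').add continuousAt_id)
    rw [detPenalty, if_pos ht] at hc
    filter_upwards [h1.eventually_const_lt hc, eventually_gt_nhds ht] with s hs hs0
    rwa [detPenalty, if_pos hs0]
  · have hct : c < ⊤ := hc.trans_le le_top
    have hr : 0 < (c.toReal + 1)⁻¹ := by positivity
    filter_upwards [eventually_lt_nhds ((not_lt.1 ht).trans_lt hr)] with s hs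
    by_cases hs0 : 0 < s
    · rw [detPenalty, if_pos hs0, gt_iff_lt, ← ENNReal.ofReal_toReal hct.ne,
        ENNReal.ofReal_lt_ofReal_iff_of_nonneg ENNReal.toReal_nonneg]
      have : c.toReal + 1 < s⁻¹ := by
        rwa [lt_inv_comm₀ (by positivity) hs0]
      linarith
    · rwa [detPenalty, if_neg hs0]

theorem aemeasurable_det {μ : Measure Plane} {G : Plane → Mat2}
    (hG : ∀ i j, AEMeasurable (fun x => G x i j) μ) : AEMeasurable (fun x => (G x).det) μ := by
  simp only [Matrix.det_fin_two]
  exact ((hG 0 0).mul (hG 1 1)).sub ((hG 0 1).mul (hG 1 0))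

theorem tendsto_det {G : ℕ → Mat2} {G₀ : Mat2}
    (h : ∀ i j, Filter.Tendsto (fun n => G n i j) Filter.atTop (𝓝 (G₀ i j))) :
    Filter.Tendsto (fun n => (G n).det) Filter.atTop (𝓝 G₀.det) := by
  simp only [Matrix.det_fin_two]
  exact ((h 0 0).mul (h 1 1)).sub ((h 0 1).mul (h 1 0))

theorem lintegral_detPenalty_le_liminf {μ : Measure Plane} {G : ℕ → Plane → Mat2}
    {G₀ : Plane → Mat2} (hG : ∀ n i j, AEMeasurable (fun x => G n x i j) μ)
    (h : ∀ᵐ x ∂μ, ∀ i j, Filter.Tendsto (fun n => G n x i j) Filter.atTop (𝓝 (G₀ x i j))) :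
    ∫⁻ x, detPenalty (G₀ x).det ∂μ ≤
      Filter.liminf (fun n => ∫⁻ x, detPenalty (G n x).det ∂μ) Filter.atTop := by
  refine le_trans (lintegral_mono_ae ?_) (lintegral_liminf_le' fun n =>
    lowerSemicontinuous_detPenalty.measurable.comp_aemeasurable (aemeasurable_det (hG n)))
  filter_upwards [h] with x hx
  refine le_of_forall_lt_imp_le_of_dense fun c hc => ?_
  refine Filter.le_liminf_of_le (by isBoundedDefault) ?_
  exact ((tendsto_det hx).eventually (lowerSemicontinuous_detPenalty _ c hc)).mono fun n hn =>
    le_of_lt hn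

theorem ae_det_pos_of_lintegral_lt_top {μ : Measure Plane} {G : Plane → Mat2}
    (hG : ∀ i j, AEMeasurable (fun x => G x i j) μ)
    (h : ∫⁻ x, detPenalty (G x).det ∂μ ≠ ⊤) : ∀ᵐ x ∂μ, 0 < (G x).det := by
  filter_upwards [ae_lt_top' (lowerSemicontinuous_detPenalty.measurable.comp_aemeasurable
    (aemeasurable_det hG)) h] with x hx
  by_contra hc
  simp [detPenalty, hc] at hx

/-- Fatou's lemma for the data term. The positivity of all determinants, including those of the
limit, keeps the gradients where the rotation part is continuous. -/
theorem lintegral_dataIntegrand_le_liminf {Ω Ω₁ : Set Plane} (hΩ : MeasurableSet Ω)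
    (S : Subgroup SO3) [Finite S]
    {I₁ I₂ : Plane → SO3 ⧸ S} (hI₁ : ContinuousOn I₁ (closure Ω))
    (hI₂ : ContinuousOn I₂ (closure Ω₁)) {φ : ℕ → Plane → Plane} {φ₀ : Plane → Plane}
    {G : ℕ → Plane → Mat2} {G₀ : Plane → Mat2}
    (hφ : ∀ n, AEMeasurable (φ n) (volume.restrict Ω))
    (hG : ∀ n i j, AEMeasurable (fun x => G n x i j) (volume.restrict Ω))
    (hφΩ : ∀ n, ∀ᵐ x ∂(volume.restrict Ω), φ n x ∈ closure Ω₁)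
    (hdet : ∀ n, ∀ᵐ x ∂(volume.restrict Ω), 0 < (G n x).det)
    (hφΩ₀ : ∀ᵐ x ∂(volume.restrict Ω), φ₀ x ∈ closure Ω₁)
    (hdet₀ : ∀ᵐ x ∂(volume.restrict Ω), 0 < (G₀ x).det)
    (h : ∀ᵐ x ∂(volume.restrict Ω), Filter.Tendsto (fun n => φ n x) Filter.atTop (𝓝 (φ₀ x)) ∧
      ∀ i j, Filter.Tendsto (fun n => G n x i j) Filter.atTop (𝓝 (G₀ x i j))) :
    ∫⁻ x in Ω, ENNReal.ofReal (dataIntegrand S I₁ I₂ (G₀ x, x, φ₀ x)) ≤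
      Filter.liminf (fun n => ∫⁻ x in Ω, ENNReal.ofReal (dataIntegrand S I₁ I₂ (G n x, x, φ n x)))
        Filter.atTop := by
  classical
  have hcont := continuousOn_dataIntegrand S hI₁ hI₂
  have hmeas : Measurable ((dataSet Ω Ω₁).piecewise (dataIntegrand S I₁ I₂) fun _ => 0) :=
    hcont.measurable_piecewise continuousOn_const (measurableSet_dataSet Ω Ω₁)
  have hmem : ∀ᵐ x ∂(volume.restrict Ω), ∀ n, (G n x, x, φ n x) ∈ dataSet Ω Ω₁ := by
    rw [ae_all_iff]
    intro n
    filter_upwards [hφΩ n, hdet n, ae_restrict_mem hΩ] with x h1 h2 h3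
    exact ⟨h2, subset_closure h3, h1⟩
  refine le_trans (lintegral_mono_ae ?_) (lintegral_liminf_le' fun n => ?_)
  · filter_upwards [hmem, hφΩ₀, hdet₀, h, ae_restrict_mem hΩ] with x h1 h2 h3 h4 h5
    have h6 : (G₀ x, x, φ₀ x) ∈ dataSet Ω Ω₁ := ⟨h3, subset_closure h5, h2⟩
    have h7 : Filter.Tendsto (fun n => ((G n x, x, φ n x) : (Fin 2 → Fin 2 → ℝ) × Plane × Plane))
        Filter.atTop (𝓝[dataSet Ω Ω₁] (G₀ x, x, φ₀ x)) := by
      refine tendsto_nhdsWithin_iff.2 ⟨?_, Filter.Eventually.of_forall h1⟩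
      refine Filter.Tendsto.prodMk_nhds ?_ (tendsto_const_nhds.prodMk_nhds h4.1)
      exact tendsto_pi_nhds.2 fun i => tendsto_pi_nhds.2 fun j => h4.2 i j
    exact ((ENNReal.continuous_ofReal.tendsto _).comp
      (Filter.Tendsto.comp (hcont _ h6) h7)).liminf_eq.ge
  · have h1 : AEMeasurable (fun x => ((G n x, x, φ n x) : (Fin 2 → Fin 2 → ℝ) × Plane × Plane))
        (volume.restrict Ω) :=
      (aemeasurable_pi_lambda _ fun i => aemeasurable_pi_lambda _ fun j => hG n i j).prodMk
        (aemeasurable_id.prodMk (hφ n))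
    refine (ENNReal.measurable_ofReal.comp_aemeasurable (hmeas.comp_aemeasurable h1)).congr ?_
    filter_upwards [hmem] with x hx
    exact congrArg ENNReal.ofReal (piecewise_eq_of_mem _ _ _ (hx n))

/-! ### A competitor of finite energy -/

theorem isWeakJacobian_ae_eq {Ω : Set Plane} (hΩ : IsOpen Ω) {φ : Plane → Plane}
    {G G' : Plane → Mat2} (h : IsWeakJacobian Ω φ G) (h' : IsWeakJacobian Ω φ G') :
    G =ᵐ[volume.restrict Ω] G' := by
  have key : ∀ i j, ∀ᵐ x, x ∈ Ω → G x i j - G' x i j = 0 := fun i j => by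
    refine hΩ.ae_eq_zero_of_integral_contDiff_smul_eq_zero
      ((h.1 i j).sub (h'.1 i j)).locallyIntegrableOn fun η h1 h2 h3 => ?_
    have hη : IsTest Ω η := ⟨h1.of_le (by exact_mod_cast le_top), h2, h3⟩
    have e1 := h.2 η hη.1 h2 h3 i j
    have e2 := h'.2 η hη.1 h2 h3 i j
    have i1 : ∀ {g : Plane → ℝ}, IntegrableOn g Ω → IntegrableOn (fun x => g x * η x) Ω :=
      fun hg => by
        obtain ⟨c, hc⟩ := hη.exists_bound
        exact hg.mul_bdd (c := c) hη.continuous.aestronglyMeasurable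
          (ae_of_all _ fun x => by simpa using hc x)
    have e3 : ∫ x, η x • (G x i j - G' x i j) = ∫ x in Ω, (G x i j - G' x i j) * η x := by
      rw [hη.setIntegral_mul]
      simp only [smul_eq_mul, mul_comm]
    rw [e3]
    simp only [sub_mul]
    rw [integral_sub (i1 (h.1 i j)) (i1 (h'.1 i j))]
    linarith
  rw [Filter.EventuallyEq, ae_restrict_iff' hΩ.measurableSet]
  filter_upwards [ae_all_iff.2 fun i => ae_all_iff.2 fun j => key i j] with x hx hxΩ
  ext i j
  exact sub_eq_zero.1 (hx i j hxΩ)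

theorem isWeakJacobian_weakJacobian {Ω : Set Plane} {φ : Plane → Plane} (h : φ ∈ W11 Ω) :
    IsWeakJacobian Ω φ (weakJacobian Ω φ) := by
  rw [weakJacobian, dif_pos h.2]
  exact h.2.choose_spec

theorem weakJacobian_ae_eq {Ω : Set Plane} (hΩ : IsOpen Ω) {φ : Plane → Plane} {G : Plane → Mat2}
    (hφ : IntegrableOn φ Ω) (hG : IsWeakJacobian Ω φ G) :
    weakJacobian Ω φ =ᵐ[volume.restrict Ω] G :=
  isWeakJacobian_ae_eq hΩ (isWeakJacobian_weakJacobian ⟨hφ, G, hG⟩) hG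

theorem totalVariation_congr_ae {Ω : Set Plane} {u u' : Plane → Mat2}
    (h : u =ᵐ[volume.restrict Ω] u') : totalVariation Ω u = totalVariation Ω u' :=
  iSup_congr fun _ => iSup_congr fun _ => congrArg ENNReal.ofReal
    (integral_congr_ae (h.mono fun x hx => by simp only [hx]))

theorem isWeakJacobian_affine {Ω : Set Plane} (hΩv : volume Ω ≠ ⊤) (c : Plane) (ε : ℝ) :
    IsWeakJacobian Ω (fun x => c + ε • x) (fun _ => ε • (1 : Mat2)) := by
  refine ⟨fun i j => integrableOn_const hΩv, fun η h1 h2 h3 i j => ?_⟩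
  have hη : IsTest Ω η := ⟨h1, h2, h3⟩
  have hd : ∀ x, HasFDerivAt (fun x : Plane => (c + ε • x) i)
      (ε • (EuclideanSpace.proj i : Plane →L[ℝ] ℝ)) x := fun x => by
    have := (((EuclideanSpace.proj i : Plane →L[ℝ] ℝ).hasFDerivAt (x := x)).const_mul ε).const_add
      (c i)
    exact this
  have hcp : HasCompactSupport (pderiv j η) :=
    (h2.fderiv (𝕜 := ℝ)).comp_left (g := fun L : Plane →L[ℝ] ℝ => L (EuclideanSpace.single j 1))
      (by simp)
  have hcont : Continuous fun x : Plane => (c + ε • x) i := by fun_prop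
  have key := integral_mul_fderiv_eq_neg_fderiv_mul_of_integrable
    (μ := (volume : Measure Plane))
    (f := fun x : Plane => (c + ε • x) i) (g := η) (v := EuclideanSpace.single j 1)
    (by
      simp only [(hd _).fderiv]
      exact (continuous_const.mul hη.continuous).integrable_of_hasCompactSupport h2.mul_left)
    ((hcont.mul (hη.continuous_pderiv j)).integrable_of_hasCompactSupport hcp.mul_left)
    ((hcont.mul hη.continuous).integrable_of_hasCompactSupport h2.mul_left)
    (fun x _ => (hd x).differentiableAt) (fun x _ => h1.differentiable one_ne_zero x)
  rw [hη.setIntegral_mul_pderiv (fun x => (c + ε • x) i),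
    hη.setIntegral_mul (fun _ => (ε • (1 : Mat2)) i j)]
  refine key.trans ?_
  simp only [(hd _).fderiv]
  congr 2
  funext x
  congr 1
  simp [Matrix.one_apply]

theorem exists_energy_lt_top {Ω Ω₁ : Set Plane} (hΩ : IsBoundedLipschitzDomain Ω)
    (hΩ₁ : IsBoundedLipschitzDomain Ω₁) (S : Subgroup SO3) [Finite S] (I₁ I₂ : Plane → SO3 ⧸ S)
    (α β : ℝ) : ∃ φ ∈ BV2 Ω Ω₁, energy Ω S I₁ I₂ α β φ < ⊤ := by
  have hΩm := hΩ.isOpen.measurableSet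
  have hfin : volume Ω < ⊤ := hΩ.isBounded.measure_lt_top
  obtain ⟨c, hc⟩ := hΩ₁.isConnected.nonempty
  obtain ⟨r, hr, hrb⟩ := Metric.isOpen_iff.1 hΩ₁.isOpen c hc
  obtain ⟨R, hR0, hR⟩ := hΩ.isBounded.exists_pos_norm_le
  set ε : ℝ := r / (2 * R) with hε
  have hε0 : 0 < ε := by positivity
  have hJ := isWeakJacobian_affine (Ω := Ω) hfin.ne c ε
  have hmem : ∀ x ∈ Ω, c + ε • x ∈ Ω₁ := fun x hx => by
    refine hrb ?_
    rw [Metric.mem_ball, dist_eq_norm, add_sub_cancel_left, norm_smul, Real.norm_eq_abs,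
      abs_of_pos hε0]
    calc ε * ‖x‖ ≤ ε * R := mul_le_mul_of_nonneg_left (hR x hx) hε0.le
      _ = r / 2 := by rw [hε]; field_simp
      _ < r := by linarith
  have hφ : IntegrableOn (fun x : Plane => c + ε • x) Ω := by
    have hcont : Continuous fun x : Plane => c + ε • x := by fun_prop
    exact (hcont.continuousOn.integrableOn_compact hΩ.isBounded.isCompact_closure).mono_set
      subset_closure
  have hW : (fun x : Plane => c + ε • x) ∈ W11 Ω := ⟨hφ, _, hJ⟩
  have hae := weakJacobian_ae_eq hΩ.isOpen hφ hJ
  have hTV : ∀ A : Mat2, totalVariation Ω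
      (fun x => weakJacobian Ω (fun x : Plane => c + ε • x) x - A) = 0 := fun A => by
    rw [totalVariation_congr_ae (u' := fun _ => ε • (1 : Mat2) - A)
      (hae.mono fun x hx => by simp only [hx]), totalVariation_const hfin.ne]
  refine ⟨fun x => c + ε • x, ⟨hW, (ae_restrict_mem hΩm).mono fun x hx =>
    subset_closure (hmem x hx), (isWeakJacobian_weakJacobian hW).1, ?_⟩, ?_⟩
  · have h0 := hTV 0
    simp only [sub_zero] at h0
    exact h0.trans_lt ENNReal.zero_lt_top
  · have h1 : dataTerm Ω S I₁ I₂ (fun x : Plane => c + ε • x) < ⊤ := by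
      refine (lintegral_mono (g := fun _ => ENNReal.ofReal (√2 * Real.pi)) fun x =>
        ENNReal.ofReal_le_ofReal (distMod_le S _ _)).trans_lt ?_
      rw [setLIntegral_const]
      exact ENNReal.mul_lt_top ENNReal.ofReal_lt_top hfin
    have h2 : ∫⁻ x in Ω, detPenalty (weakJacobian Ω (fun x : Plane => c + ε • x) x).det < ⊤ := by
      rw [lintegral_congr_ae (g := fun _ => detPenalty (ε • (1 : Mat2)).det)
        (hae.mono fun x hx => by simp only [hx]), setLIntegral_const]
      refine ENNReal.mul_lt_top ?_ hfin
      rw [detPenalty, if_pos]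
      · exact ENNReal.ofReal_lt_top
      · simp [hε0]
    rw [energy, hTV 1, mul_zero, add_zero]
    exact ENNReal.add_lt_top.2 ⟨h1, ENNReal.mul_lt_top ENNReal.ofReal_lt_top h2⟩

/-! ### Existence of minimizers -/

theorem aemeasurable_entries {Ω : Set Plane} {φ : Plane → Plane} (h : φ ∈ W11 Ω) (i j : Fin 2) :
    AEMeasurable (fun x => weakJacobian Ω φ x i j) (volume.restrict Ω) :=
  ((isWeakJacobian_weakJacobian h).1 i j).1.aemeasurable

/-- A sequence of admissible maps of bounded energy has a subsequence whose limit is admissible and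
has energy at most the limit inferior of the energies. -/
theorem exists_energy_le_liminf {Ω Ω₁ : Set Plane} (hΩ : IsBoundedLipschitzDomain Ω)
    (hΩ₁ : Bornology.IsBounded Ω₁) (S : Subgroup SO3) [Finite S]
    {I₁ I₂ : Plane → SO3 ⧸ S} (hI₁ : ContinuousOn I₁ (closure Ω))
    (hI₂ : ContinuousOn I₂ (closure Ω₁)) {α β : ℝ} (hα : 0 < α) (hβ : 0 < β)
    {φ : ℕ → Plane → Plane} (hφ : ∀ n, φ n ∈ BV2 Ω Ω₁) {B : ℝ≥0∞} (hB : B ≠ ⊤)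
    (hE : ∀ n, energy Ω S I₁ I₂ α β (φ n) ≤ B) :
    ∃ ns : ℕ → ℕ, StrictMono ns ∧ ∃ φ₀ ∈ BV2 Ω Ω₁, energy Ω S I₁ I₂ α β φ₀ ≤
      Filter.liminf (fun k => energy Ω S I₁ I₂ α β (φ (ns k))) Filter.atTop := by
  have hΩm := hΩ.isOpen.measurableSet
  have hfin : volume Ω ≠ ⊤ := hΩ.isBounded.measure_lt_top.ne
  have hJ := fun n => isWeakJacobian_weakJacobian (hφ n).1
  have hα' : ENNReal.ofReal α ≠ 0 := by simpa using hα
  have hβ' : ENNReal.ofReal β ≠ 0 := by simpa using hβ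
  obtain ⟨M, hM⟩ := hΩ₁.closure.exists_norm_le
  have hMn : ∀ n i, ∀ᵐ x ∂(volume.restrict Ω), |φ n x i| ≤ M := fun n i => by
    filter_upwards [(hφ n).2.1] with x hx
    exact le_trans (by simpa using PiLp.norm_apply_le (φ n x) i) (hM _ hx)
  have hTV : ∀ n, totalVariation Ω (weakJacobian Ω (φ n)) ≤
      ENNReal.ofReal (B / ENNReal.ofReal α).toReal := fun n => by
    rw [ENNReal.ofReal_toReal (ENNReal.div_ne_top hB hα'),
      ENNReal.le_div_iff_mul_le (Or.inl hα') (Or.inl ENNReal.ofReal_ne_top), mul_comm,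
      ← totalVariation_sub_const hfin (hJ n).1 1]
    refine le_trans ?_ (hE n)
    exact le_add_right le_add_self
  have hdet : ∀ n, ∀ᵐ x ∂(volume.restrict Ω), 0 < (weakJacobian Ω (φ n) x).det := fun n => by
    refine ae_det_pos_of_lintegral_lt_top (aemeasurable_entries (hφ n).1) fun htop => hB ?_
    have h1 : ENNReal.ofReal β * ∫⁻ x in Ω, detPenalty (weakJacobian Ω (φ n) x).det ≤ B :=
      le_trans le_add_self (hE n)
    rw [htop, ENNReal.mul_top hβ'] at h1
    exact top_le_iff.1 h1
  obtain ⟨ns, hns, φ₀, G₀, hφ₀, hG₀, hL, hae⟩ := hΩ.exists_convergent_subseq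
    (fun n => (hφ n).1.1) hJ hMn fun n i j =>
      varBound_of_totalVariation_le hΩm ENNReal.toReal_nonneg (hTV n) i j
  refine ⟨ns, hns, φ₀, ?_⟩
  have hW : φ₀ ∈ W11 Ω := ⟨hφ₀, G₀, hG₀⟩
  have hJ₀ := isWeakJacobian_weakJacobian hW
  have heq := weakJacobian_ae_eq hΩ.isOpen hφ₀ hG₀
  replace hL : ∀ i j, Filter.Tendsto (fun k => ∫ x in Ω, |weakJacobian Ω (φ (ns k)) x i j
      - weakJacobian Ω φ₀ x i j|) Filter.atTop (𝓝 0) := fun i j =>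
    (hL i j).congr fun k => integral_congr_ae (heq.mono fun x hx => by simp only [hx])
  replace hae : ∀ᵐ x ∂(volume.restrict Ω),
      Filter.Tendsto (fun k => φ (ns k) x) Filter.atTop (𝓝 (φ₀ x)) ∧
      ∀ i j, Filter.Tendsto (fun k => weakJacobian Ω (φ (ns k)) x i j) Filter.atTop
        (𝓝 (weakJacobian Ω φ₀ x i j)) := by
    filter_upwards [hae, heq] with x hx hx'
    rw [hx']
    exact hx
  have hcl : ∀ᵐ x ∂(volume.restrict Ω), φ₀ x ∈ closure Ω₁ := by
    filter_upwards [hae, ae_all_iff.2 fun n => (hφ n).2.1] with x hx hx'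
    exact isClosed_closure.mem_of_tendsto hx.1 (Filter.Eventually.of_forall fun k => hx' _)
  have hTV₀ := totalVariation_le_liminf (fun k => (hJ (ns k)).1) hJ₀.1 hL
  have hdet₀ := lintegral_detPenalty_le_liminf
    (fun k => aemeasurable_entries (hφ (ns k)).1) (hae.mono fun x hx => hx.2)
  have hbound : ∀ {u : ℕ → ℝ≥0∞} {b : ℝ≥0∞}, (∀ n, u n ≤ b) →
      Filter.liminf u Filter.atTop ≤ b := fun hu =>
    (Filter.liminf_le_liminf (Filter.Eventually.of_forall hu)).trans_eq
      (Filter.liminf_const _)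
  have hTVfin : totalVariation Ω (weakJacobian Ω φ₀) < ⊤ :=
    (hTV₀.trans (hbound fun k => hTV (ns k))).trans_lt ENNReal.ofReal_lt_top
  have hdetpos : ∀ᵐ x ∂(volume.restrict Ω), 0 < (weakJacobian Ω φ₀ x).det := by
    refine ae_det_pos_of_lintegral_lt_top (aemeasurable_entries hW) (ne_of_lt ?_)
    refine (hdet₀.trans (hbound (b := B / ENNReal.ofReal β) fun k => ?_)).trans_lt
      (ENNReal.div_lt_top hB hβ')
    rw [ENNReal.le_div_iff_mul_le (Or.inl hβ') (Or.inl ENNReal.ofReal_ne_top), mul_comm]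
    exact le_trans le_add_self (hE (ns k))
  refine ⟨⟨hW, hcl, hJ₀.1, hTVfin⟩, ?_⟩
  have hdata : dataTerm Ω S I₁ I₂ φ₀ ≤
      Filter.liminf (fun k => dataTerm Ω S I₁ I₂ (φ (ns k))) Filter.atTop :=
    lintegral_dataIntegrand_le_liminf hΩm S hI₁ hI₂
      (fun k => (hφ (ns k)).1.1.1.aemeasurable) (fun k => aemeasurable_entries (hφ (ns k)).1)
      (fun k => (hφ (ns k)).2.1) (fun k => hdet (ns k)) hcl hdetpos hae
  have hTV₁ : totalVariation Ω (fun x => weakJacobian Ω φ₀ x - 1) ≤ Filter.liminf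
      (fun k => totalVariation Ω fun x => weakJacobian Ω (φ (ns k)) x - 1) Filter.atTop := by
    simp only [totalVariation_sub_const hfin hJ₀.1, totalVariation_sub_const hfin (hJ _).1]
    exact hTV₀
  have hTV₂ := mul_le_mul_right hTV₁ (ENNReal.ofReal α)
  have hdet₂ := mul_le_mul_right hdet₀ (ENNReal.ofReal β)
  rw [← ENNReal.liminf_const_mul_of_ne_top ENNReal.ofReal_ne_top] at hTV₂ hdet₂
  exact (add_le_add ((add_le_add hdata hTV₂).trans (add_liminf_le_liminf_add _ _)) hdet₂).trans
    (add_liminf_le_liminf_add _ _)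

end EBSDFlow
end

theorem mainTheorem2
    (Ω Ω₁ : Set EBSDFlow.Plane)
    (hΩ : EBSDFlow.IsBoundedLipschitzDomain Ω) (hΩ₁ : EBSDFlow.IsBoundedLipschitzDomain Ω₁)
    (S : Subgroup EBSDFlow.SO3) (hS : Finite S)
    (I₁ I₂ : EBSDFlow.Plane → EBSDFlow.SO3 ⧸ S)
    (hI₁ : ContinuousOn I₁ (closure Ω)) (hI₂ : ContinuousOn I₂ (closure Ω₁))
    (α β : ℝ) (hα : 0 < α) (hβ : 0 < β) :
    ∃ φ ∈ EBSDFlow.BV2 Ω Ω₁,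
      EBSDFlow.energy Ω S I₁ I₂ α β φ < ⊤ ∧
      ∀ ψ ∈ EBSDFlow.BV2 Ω Ω₁,
        EBSDFlow.energy Ω S I₁ I₂ α β φ ≤ EBSDFlow.energy Ω S I₁ I₂ α β ψ := by
  set E := EBSDFlow.energy Ω S I₁ I₂ α β
  obtain ⟨φ₁, hφ₁, hE₁⟩ := EBSDFlow.exists_energy_lt_top hΩ hΩ₁ S I₁ I₂ α β
  set m := sInf (E '' EBSDFlow.BV2 Ω Ω₁) with hm
  have hmtop : m < ⊤ := (sInf_le (mem_image_of_mem E hφ₁)).trans_lt hE₁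
  obtain ⟨e, -, he, hmem⟩ := exists_seq_tendsto_sInf (S := E '' EBSDFlow.BV2 Ω Ω₁)
    ⟨_, mem_image_of_mem E hφ₁⟩ (OrderBot.bddBelow _)
  choose φ hφ hφe using hmem
  -- the minimizing sequence is cut off at its start, where the energy may be infinite
  obtain ⟨N, hN⟩ := Filter.eventually_atTop.1 (he.eventually_lt_const
    (ENNReal.lt_add_right hmtop.ne one_ne_zero))
  obtain ⟨ns, hns, φ₀, hφ₀, hle⟩ := EBSDFlow.exists_energy_le_liminf hΩ hΩ₁.isBounded S hI₁ hI₂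
    hα hβ (fun n => hφ (n + N)) (B := m + 1) (by finiteness) fun n => by
      have := (hN (n + N) (Nat.le_add_left _ _)).le
      rwa [← hφe] at this
  have hlim : Filter.Tendsto (fun k => E (φ (ns k + N))) Filter.atTop (𝓝 m) := by
    simp only [hφe]
    exact he.comp ((Filter.tendsto_add_atTop_nat N).comp hns.tendsto_atTop)
  have hmin : E φ₀ ≤ m := hle.trans_eq hlim.liminf_eq
  exact ⟨φ₀, hφ₀, hmin.trans_lt hmtop, fun ψ hψ => hmin.trans (sInf_le (mem_image_of_mem E hψ))⟩
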